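/- Let $G$ be a locally compact abelian (Hausdorff) group, written multiplicatively, with (regular) Haar measure $\mu$, and let $K_1, K_2$ be uniform lattices in $G$, i.e. discrete subgroups with $G/K_1$, $G/K_2$ compact. Give $G/K_i$ the Haar measure normalised by $\int_G f\,d\mu=\int_{G/K_i}\sum_{k\in K_i} f(xk)\,dx$ for every continuous compactly supported $f$ on $G$, and let $|G/K_2|$ be the total mass of $G/K_2$. Let $\mathrm{Ann}(K_2)$ be the group of continuous characters $\gamma$ of $G$ with $\gamma(k)=1$ for all $k\in K_2$. For $g\in L^2(G)$, $k_1\in K_1$ and $\gamma_2\in \mathrm{Ann}(K_2)$ put $\Theta^g_{k_1,\gamma_2}(t)=\gamma_2(t)\,g(tk_1^{-1})$. Suprema and infima below are essential ones, with respect to Haar measure on $G/K_1$. Let $g\in L^2(G)$ be such that $$B:=|G/K_2|\,\sup_{x\in G/K_1}\ \sum_{k_2\in K_2}\Big|\sum_{k_1\in K_1} g(xk_1^{-1})\,\overline{g(xk_1^{-1}k_2^{-1})}\Big|<\infty .$$ Then $\{\Theta^g_{k_1,\gamma_2}\}_{(k_1,\gamma_2)\in K_1\times \mathrm{Ann}(K_2)}$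 is a Bessel family with bound $B$: $$\sum_{k_1\in K_1}\sum_{\gamma_2\in\mathrm{Ann}(K_2)}|\langle f,\Theta^g_{k_1,\gamma_2}\rangle|^2\le B\,\|f\|^2\qquad\text{for all } f\in L^2(G).$$ If moreover $$A:=|G/K_2|\,\inf_{x\in G/K_1}\Big[\sum_{k_1\in K_1}|g(xk_1^{-1})|^2-\sum_{1\ne k_2\in K_2}\Big|\sum_{k_1\in K_1} g(xk_1^{-1})\,\overline{g(xk_1^{-1}k_2^{-1})}\Big|\Big]>0,$$ then $\{\Theta^g_{k_1,\gamma_2}\}$ is a frame for $L^2(G)$ with bounds $A,B$, i.e. also $A\,\|f\|^2\le\sum_{k_1,\gamma_2}|\langle f,\Theta^g_{k_1,\gamma_2}\rangle|^2$ for all $f\in L^2(G)$. -/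

import Mathlib

open MeasureTheory
open scoped ENNReal ComplexConjugate

namespace GenGabor

section Frames

variable {ι H : Type*} [NormedAddCommGroup H] [InnerProductSpace ℂ H]

/-- The family `v` is a Bessel family in the Hilbert space `H` with (upper) bound `B`:
`∑ᵢ |⟨f, vᵢ⟩|²` converges and is at most `B ‖f‖²`, for every `f`. -/
def IsBesselWithBound (v : ι → H) (B : ℝ) : Prop :=
  ∀ f : H, Summable (fun i => ‖inner ℂ (v i) f‖ ^ 2) ∧
    ∑' i, ‖inner ℂ (v i) f‖ ^ 2 ≤ B * ‖f‖ ^ 2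

/-- The family `v` is a frame for the Hilbert space `H` with frame bounds `A, B > 0`. -/
def IsFrameWithBounds (v : ι → H) (A B : ℝ) : Prop :=
  0 < A ∧ 0 < B ∧ ∀ f : H, Summable (fun i => ‖inner ℂ (v i) f‖ ^ 2) ∧
    A * ‖f‖ ^ 2 ≤ ∑' i, ‖inner ℂ (v i) f‖ ^ 2 ∧
    ∑' i, ‖inner ℂ (v i) f‖ ^ 2 ≤ B * ‖f‖ ^ 2

end Frames

section Lattices

variable {G : Type*} [CommGroup G] [TopologicalSpace G]

/-- A uniform lattice: a discrete subgroup `K` of `G` such that `G ⧸ K` is compact. -/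
structure IsUniformLattice (K : Subgroup G) : Prop where
  discrete : DiscreteTopology K
  cocompact : CompactSpace (G ⧸ K)

/-- The annihilator of `K`: the continuous unitary characters of `G` that are trivial on `K`. -/
def annihilator (K : Subgroup G) : Subgroup (PontryaginDual G) where
  carrier := {γ | ∀ k ∈ K, γ k = 1}
  one_mem' := fun _ _ => rfl
  mul_mem' := by
    intro a b ha hb k hk
    change a k * b k = 1
    rw [ha k hk, hb k hk, one_mul]
  inv_mem' := by
    intro a ha k hk
    change (a k)⁻¹ = 1
    rw [ha k hk, inv_one]

variable [MeasurableSpace G]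

/-- `F` is a relatively compact measurable set which contains exactly one point of each coset
of `K`. -/
structure IsFundamentalSet (K : Subgroup G) (F : Set G) : Prop where
  measurable : MeasurableSet F
  relCompact : ∃ C : Set G, IsCompact C ∧ F ⊆ C
  injective : ∀ x ∈ F, ∀ y ∈ F, x⁻¹ * y ∈ K → x = y
  covers : ∀ x : G, ∃ k ∈ K, x * k ∈ F

variable [IsTopologicalGroup G] [LocallyCompactSpace G] [BorelSpace G]

theorem IsUniformLattice.exists_isFundamentalSet {K : Subgroup G} (hK : IsUniformLattice K) :
    ∃ F : Set G, IsFundamentalSet K F := by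
  have := hK.discrete
  have := hK.cocompact
  -- a relatively compact open neighbourhood `V` of `1` on which the quotient map is injective
  obtain ⟨U, hUo, hU⟩ : ∃ U : Set G, IsOpen U ∧ Subtype.val ⁻¹' U = ({1} : Set K) := by
    have := isOpen_discrete ({1} : Set K)
    rwa [isOpen_induced_iff] at this
  have hU1 : (1 : G) ∈ U := by
    have : (1 : K) ∈ (Subtype.val ⁻¹' U : Set K) := by rw [hU]; rfl
    exact this
  have hUK : ∀ k ∈ K, k ∈ U → k = 1 := by
    intro k hk hkU
    have : (⟨k, hk⟩ : K) ∈ (Subtype.val ⁻¹' U : Set K) := hkU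
    rw [hU] at this
    exact congrArg Subtype.val (Set.mem_singleton_iff.1 this)
  obtain ⟨V, hVo, hV1, hVU⟩ :
      ∃ V : Set G, IsOpen V ∧ (1 : G) ∈ V ∧ ∀ x ∈ V, ∀ y ∈ V, x⁻¹ * y ∈ U := by
    have hc : Continuous (fun p : G × G => p.1⁻¹ * p.2) := by fun_prop
    have hn : (fun p : G × G => p.1⁻¹ * p.2) ⁻¹' U ∈ nhds ((1 : G), (1 : G)) :=
      hc.continuousAt.preimage_mem_nhds (hUo.mem_nhds (by simpa using hU1))
    rw [nhds_prod_eq, Filter.mem_prod_self_iff] at hn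
    obtain ⟨t, ht, htU⟩ := hn
    obtain ⟨V, hVt, hVo, hV1⟩ := mem_nhds_iff.1 ht
    exact ⟨V, hVo, hV1, fun x hx y hy => htU (Set.mk_mem_prod (hVt hx) (hVt hy))⟩
  obtain ⟨C, hC, hC1⟩ := exists_compact_mem_nhds (1 : G)
  set W : Set G := V ∩ interior C with hW
  have hWo : IsOpen W := hVo.inter isOpen_interior
  have hW1 : (1 : G) ∈ W := ⟨hV1, mem_interior_iff_mem_nhds.2 hC1⟩
  have hWinj : ∀ x ∈ W, ∀ y ∈ W, x⁻¹ * y ∈ K → x = y := by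
    intro x hx y hy h
    exact (inv_mul_eq_one.1 (hUK _ h (hVU x hx.1 y hy.1)))
  let T : G → Set G := fun a => (fun y => a⁻¹ * y) ⁻¹' W
  have hTo : ∀ a, IsOpen (T a) := fun a => hWo.preimage (by fun_prop)
  -- greedy construction over a finite set of translates
  have key : ∀ t : Finset G, ∃ F : Set G, MeasurableSet F ∧ F ⊆ ⋃ a ∈ t, T a ∧
      (∀ x ∈ F, ∀ y ∈ F, x⁻¹ * y ∈ K → x = y) ∧
      ∀ a ∈ t, ∀ x ∈ T a, ∃ k ∈ K, x * k ∈ F := by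
    classical
    intro t
    induction t using Finset.induction_on with
    | empty => exact ⟨∅, MeasurableSet.empty, by simp, by simp, by simp⟩
    | insert a t _ ih =>
      obtain ⟨F, hFm, hFt, hFi, hFc⟩ := ih
      let S : Set G := ⋃ k : K, ⋃ b ∈ t, (fun y => y * (k : G)) ⁻¹' T b
      have hSo : IsOpen S :=
        isOpen_iUnion fun k => isOpen_biUnion fun b _ => (hTo b).preimage (by fun_prop)
      have hFS : ∀ x ∈ F, ∀ k ∈ K, x * k ∈ S := by
        intro x hx k hk
        obtain ⟨b, hb, hxb⟩ := Set.mem_iUnion₂.1 (hFt hx)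
        refine Set.mem_iUnion.2 ⟨⟨k⁻¹, K.inv_mem hk⟩, Set.mem_iUnion₂.2 ⟨b, hb, ?_⟩⟩
        simpa using hxb
      refine ⟨F ∪ (T a \ S), hFm.union ((hTo a).measurableSet.diff hSo.measurableSet), ?_, ?_, ?_⟩
      · rintro x (hx | hx)
        · obtain ⟨b, hb, hxb⟩ := Set.mem_iUnion₂.1 (hFt hx)
          exact Set.mem_iUnion₂.2 ⟨b, Finset.mem_insert_of_mem hb, hxb⟩
        · exact Set.mem_iUnion₂.2 ⟨a, Finset.mem_insert_self a t, hx.1⟩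
      · rintro x (hx | hx) y (hy | hy) h
        · exact hFi x hx y hy h
        · exact absurd (by simpa using hFS x hx _ h) hy.2
        · have h' := hFS y hy _ (K.inv_mem h)
          rw [mul_inv_rev, inv_inv, mul_inv_cancel_left] at h'
          exact absurd h' hx.2
        · have := hWinj _ hx.1 _ hy.1 (by simpa [mul_assoc] using h)
          exact mul_left_cancel this
      · intro b hb x hx
        rcases Finset.mem_insert.1 hb with rfl | hb
        · by_cases hxS : x ∈ S
          · obtain ⟨k, hk⟩ := Set.mem_iUnion.1 hxS
            obtain ⟨c, hc, hxc⟩ := Set.mem_iUnion₂.1 hk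
            obtain ⟨k', hk', hm⟩ := hFc c hc _ hxc
            exact ⟨k * k', K.mul_mem k.2 hk', Or.inl (by simpa [mul_assoc] using hm)⟩
          · exact ⟨1, K.one_mem, Or.inr (by simpa using ⟨hx, hxS⟩)⟩
        · obtain ⟨k, hk, hm⟩ := hFc b hb x hx
          exact ⟨k, hk, Or.inl hm⟩
  -- finitely many translates suffice
  obtain ⟨t, ht⟩ := (isCompact_univ (X := G ⧸ K)).elim_finite_subcover
    (fun a : G => (QuotientGroup.mk : G → G ⧸ K) '' T a)
    (fun a => QuotientGroup.isOpenMap_coe _ (hTo a)) (by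
      intro q _
      obtain ⟨x, rfl⟩ := QuotientGroup.mk_surjective q
      exact Set.mem_iUnion.2 ⟨x, x, by simpa [T] using hW1, rfl⟩)
  obtain ⟨F, hFm, hFt, hFi, hFc⟩ := key t
  refine ⟨F, hFm, ⟨⋃ a ∈ t, (fun y => a * y) '' C, ?_, ?_⟩, hFi, ?_⟩
  · exact t.isCompact_biUnion fun a _ => hC.image (by fun_prop)
  · intro x hx
    obtain ⟨b, hb, hxb⟩ := Set.mem_iUnion₂.1 (hFt hx)
    exact Set.mem_iUnion₂.2 ⟨b, hb, b⁻¹ * x, interior_subset hxb.2, by simp⟩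
  · intro x
    obtain ⟨a, ha, y, hy, hyx⟩ := Set.mem_iUnion₂.1 (ht (Set.mem_univ (x : G ⧸ K)))
    obtain ⟨k, hk, hm⟩ := hFc a ha y hy
    refine ⟨(x⁻¹ * y) * k, K.mul_mem ?_ hk, by simpa [mul_assoc] using hm⟩
    exact QuotientGroup.eq.1 hyx.symm

/-- A fixed relatively compact Borel set of representatives for `G ⧸ K`. -/
noncomputable def fundamentalSet {K : Subgroup G} (hK : IsUniformLattice K) : Set G :=
  hK.exists_isFundamentalSet.choose

theorem isFundamentalSet_fundamentalSet {K : Subgroup G} (hK : IsUniformLattice K) :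
    IsFundamentalSet K (fundamentalSet hK) :=
  hK.exists_isFundamentalSet.choose_spec

/-- The Haar measure `dx` of `G ⧸ K`, normalised in the usual way by
`∫_G f dμ = ∫_{G ⧸ K} ∑_{k ∈ K} f (x k) dx` (see `lintegral_quotientMeasure`). It is the image
of `μ` restricted to a relatively compact Borel set of representatives, and does not depend on
the choice of that set. -/
noncomputable def quotientMeasure (μ : Measure G) {K : Subgroup G} (hK : IsUniformLattice K) :
    Measure (G ⧸ K) :=
  (μ.restrict (fundamentalSet hK)).map QuotientGroup.mk

/-- Periodisation of `f` over `K`, as a function on `G ⧸ K`. -/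
noncomputable def periodize (K : Subgroup G) (f : G → ℝ≥0∞) : G ⧸ K → ℝ≥0∞ :=
  Quotient.lift (fun x : G => ∑' k : K, f (x * k)) (by
    intro x y h
    have h : x⁻¹ * y ∈ K := QuotientGroup.leftRel_apply.1 h
    refine ((Equiv.mulLeft (⟨x⁻¹ * y, h⟩ : K)).tsum_eq
      (fun k : K => f (x * k))).symm.trans ?_
    simp [mul_assoc])

/-- Weil's formula, which is what characterises `quotientMeasure`. -/
theorem lintegral_quotientMeasure [T2Space G] (μ : Measure G) [μ.IsHaarMeasure]
    {K : Subgroup G} (hK : IsUniformLattice K) (f : G → ℝ≥0∞) (hf : Continuous f)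
    (hfc : ∃ C : Set G, IsCompact C ∧ ∀ x ∉ C, f x = 0) :
    ∫⁻ x, f x ∂μ = ∫⁻ q, periodize K f q ∂(quotientMeasure μ hK) := by
  classical
  have := hK.discrete
  obtain ⟨C, hC, hfC⟩ := hfc
  have hF := isFundamentalSet_fundamentalSet hK
  set F := fundamentalSet hK with hFdef
  -- over a compact set, only finitely many terms matter
  have hfin : ∀ D : Set G, IsCompact D → ∃ S : Finset K, ∀ x ∈ D, ∀ k : K, k ∉ S →
      x * k ∉ C := by
    intro D hD
    have h1 : IsCompact ((fun p : G × G => p.1⁻¹ * p.2) '' (D ×ˢ C)) :=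
      (hD.prod hC).image (by fun_prop)
    have h2 : Topology.IsClosedEmbedding (Subtype.val : K → G) :=
      (Subgroup.isClosed_of_discrete (H := K)).isClosedEmbedding_subtypeVal
    have h3 := (h2.isCompact_preimage h1).finite_of_discrete
    refine ⟨h3.toFinset, fun x hx k hk hxk => hk ?_⟩
    rw [Set.Finite.mem_toFinset]
    exact ⟨(x, x * k), ⟨hx, hxk⟩, by simp⟩
  have hcont : Continuous (fun x : G => ∑' k : K, f (x * k)) := by
    rw [continuous_iff_continuousAt]
    intro x
    obtain ⟨D, hD, hDx⟩ := exists_compact_mem_nhds x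
    obtain ⟨S, hS⟩ := hfin D hD
    have h1 : ContinuousAt (fun x : G => ∑ k ∈ S, f (x * k)) x :=
      (continuous_finsetSum S fun k _ => hf.comp (by fun_prop)).continuousAt
    refine h1.congr (Filter.mem_of_superset hDx fun y hy => ?_)
    exact (tsum_eq_sum fun k hk => hfC _ (hS y hy k hk)).symm
  have hmk : Measurable (QuotientGroup.mk : G → G ⧸ K) := fun s hs => hs
  have hper : Measurable (periodize K f) := fun s hs => hcont.measurable hs
  obtain ⟨D, hD, hFD⟩ := hF.relCompact
  obtain ⟨S, hS⟩ := hfin D hD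
  rw [quotientMeasure, lintegral_map hper hmk]
  change _ = ∫⁻ x in F, ∑' k : K, f (x * k) ∂μ
  have h1 : ∫⁻ x in F, ∑' k : K, f (x * k) ∂μ = ∑ k ∈ S, ∫⁻ x in F, f (x * k) ∂μ := by
    rw [← lintegral_finsetSum S (f := fun (k : K) (x : G) => f (x * k))
      fun k _ => (hf.comp (by fun_prop : Continuous fun x : G => x * (k : G))).measurable]
    exact setLIntegral_congr_fun hF.measurable fun x hx =>
      tsum_eq_sum fun k hk => hfC _ (hS x (hFD hx) k hk)
  let P : K → Set G := fun k => (fun x => x * (k : G)⁻¹) ⁻¹' F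
  have hPm : ∀ k, MeasurableSet (P k) := fun k => hF.measurable.preimage (by fun_prop)
  have h2 : ∀ k : K, ∫⁻ x in F, f (x * k) ∂μ = ∫⁻ x in P k, f x ∂μ := by
    intro k
    rw [← lintegral_indicator hF.measurable, ← lintegral_indicator (hPm k),
      ← lintegral_mul_right_eq_self (μ := μ) ((P k).indicator fun x => f x) (k : G)]
    congr 1
    ext x
    simp [P, Set.indicator]
  have hdisj : Set.PairwiseDisjoint (S : Set K) P := by
    intro a _ b _ hab
    refine Set.disjoint_left.2 fun x hxa hxb => hab ?_
    have := hF.injective _ hxa _ hxb (by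
      have : (x * (a : G)⁻¹)⁻¹ * (x * (b : G)⁻¹) = a * (b : G)⁻¹ := by group
      rw [this]
      exact K.mul_mem a.2 (K.inv_mem b.2))
    exact Subtype.ext (inv_injective (mul_left_cancel this))
  rw [h1, Finset.sum_congr rfl fun k _ => h2 k,
    ← lintegral_biUnion_finset hdisj fun k _ => hPm k]
  refine (setLIntegral_eq_of_support_subset ?_).symm
  intro x hx
  obtain ⟨k, hk, hxk⟩ := hF.covers x
  refine Set.mem_iUnion₂.2 ⟨⟨k⁻¹, K.inv_mem hk⟩, ?_, by simpa [P] using hxk⟩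
  by_contra hkS
  refine hS (x * k) (hFD hxk) _ hkS ?_
  by_contra hxC
  exact hx (hfC x (by simpa using hxC))

end Lattices

section Gabor

variable {G : Type*} [CommGroup G] [TopologicalSpace G] [IsTopologicalGroup G]
  [MeasurableSpace G] [BorelSpace G]

theorem memLp_timeFreq (μ : Measure G) [μ.IsHaarMeasure] (g : Lp ℂ 2 μ) (x : G)
    (γ : PontryaginDual G) :
    MemLp (fun t : G => (γ t : ℂ) * g (t * x⁻¹)) 2 μ := by
  have h1 : MemLp (fun t : G => g (t * x⁻¹)) 2 μ :=
    (Lp.memLp g).comp_measurePreserving (measurePreserving_mul_right μ x⁻¹)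
  have hγ : Continuous (fun t : G => (γ t : ℂ)) :=
    continuous_subtype_val.comp (map_continuous γ)
  refine h1.of_le (hγ.aestronglyMeasurable.mul h1.1) (Filter.Eventually.of_forall fun t => ?_)
  rw [norm_mul, Circle.norm_coe, one_mul]

/-- The time-frequency shift `γ T_x g`, i.e. `t ↦ γ(t) g(t x⁻¹)`, as an element of `L²(G)`. -/
noncomputable def timeFreq (μ : Measure G) [μ.IsHaarMeasure] (x : G) (γ : PontryaginDual G)
    (g : Lp ℂ 2 μ) : Lp ℂ 2 μ :=
  (memLp_timeFreq μ g x γ).toLp _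

/-- The generalized Gabor system `{γ₂ T_{k₁} g : (k₁, γ₂) ∈ K₁ × Ann(K₂)}`. -/
noncomputable def gaborSystem (μ : Measure G) [μ.IsHaarMeasure] (K₁ K₂ : Subgroup G)
    (g : Lp ℂ 2 μ) : K₁ × annihilator K₂ → Lp ℂ 2 μ :=
  fun p => timeFreq μ (p.1 : G) (p.2 : PontryaginDual G) g

/-- The function `x ↦ ∑_{k₁ ∈ K₁} g(x k₁⁻¹) conj (g(x k₁⁻¹ k⁻¹))` on `G ⧸ K₁`.
For `g` in `L²(G)` the series converges absolutely for almost all `x`. -/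
noncomputable def correlation (K₁ : Subgroup G) (g : G → ℂ) (k : G) : G ⧸ K₁ → ℂ :=
  Quotient.lift
    (fun x : G => ∑' k₁ : K₁, g (x * (k₁ : G)⁻¹) * conj (g (x * (k₁ : G)⁻¹ * k⁻¹))) (by
      intro x y h
      have h : x⁻¹ * y ∈ K₁ := QuotientGroup.leftRel_apply.1 h
      refine ((Equiv.mulLeft (⟨x⁻¹ * y, h⟩ : K₁)⁻¹).tsum_eq (fun k₁ : K₁ =>
        g (x * (k₁ : G)⁻¹) * conj (g (x * (k₁ : G)⁻¹ * k⁻¹)))).symm.trans ?_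
      have hxy : ∀ k₁ : G, x * (k₁⁻¹ * (x⁻¹ * y)) = y * k₁⁻¹ := by
        intro k₁
        rw [mul_comm k₁⁻¹, ← mul_assoc, mul_inv_cancel_left]
      simp [hxy])

/-- The function `x ↦ ∑_{k₁ ∈ K₁} |g(x k₁⁻¹)|²` on `G ⧸ K₁`. -/
noncomputable def diagonal (K₁ : Subgroup G) (g : G → ℂ) : G ⧸ K₁ → ℝ :=
  Quotient.lift (fun x : G => ∑' k₁ : K₁, ‖g (x * (k₁ : G)⁻¹)‖ ^ 2) (by
    intro x y h
    have h : x⁻¹ * y ∈ K₁ := QuotientGroup.leftRel_apply.1 h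
    refine ((Equiv.mulLeft (⟨x⁻¹ * y, h⟩ : K₁)⁻¹).tsum_eq (fun k₁ : K₁ =>
      ‖g (x * (k₁ : G)⁻¹)‖ ^ 2)).symm.trans ?_
    have hxy : ∀ k₁ : G, x * (k₁⁻¹ * (x⁻¹ * y)) = y * k₁⁻¹ := by
      intro k₁
      rw [mul_comm k₁⁻¹, ← mul_assoc, mul_inv_cancel_left]
    simp [hxy])

variable [LocallyCompactSpace G]

/-- `B = |G/K₂| sup_{x ∈ G/K₁} ∑_{k₂ ∈ K₂} |∑_{k₁ ∈ K₁} g(x k₁⁻¹) conj (g(x k₁⁻¹ k₂⁻¹))|`,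
with values in `[0, ∞]`. As `g` is an element of `L²(G)`, the supremum is the essential one. -/
noncomputable def upperBound (μ : Measure G) {K₁ K₂ : Subgroup G} (hK₁ : IsUniformLattice K₁)
    (hK₂ : IsUniformLattice K₂) (g : Lp ℂ 2 μ) : ℝ≥0∞ :=
  quotientMeasure μ hK₂ Set.univ *
    essSup (fun x : G ⧸ K₁ => ∑' k₂ : K₂, ‖correlation K₁ g (k₂ : G) x‖ₑ)
      (quotientMeasure μ hK₁)

/-- `A = |G/K₂| inf_{x ∈ G/K₁} [∑_{k₁ ∈ K₁} |g(x k₁⁻¹)|² -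
∑_{1 ≠ k₂ ∈ K₂} |∑_{k₁ ∈ K₁} g(x k₁⁻¹) conj (g(x k₁⁻¹ k₂⁻¹))|]` (essential infimum). If the
quantity `upperBound` is finite, all sums converge almost everywhere and the bracket is
essentially bounded. -/
noncomputable def lowerBound (μ : Measure G) {K₁ K₂ : Subgroup G} (hK₁ : IsUniformLattice K₁)
    (hK₂ : IsUniformLattice K₂) (g : Lp ℂ 2 μ) : ℝ :=
  (quotientMeasure μ hK₂).real Set.univ *
    essInf (fun x : G ⧸ K₁ => diagonal K₁ g x -
        ∑' k₂ : {k : K₂ // k ≠ 1}, ‖correlation K₁ g ((k₂ : K₂) : G) x‖)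
      (quotientMeasure μ hK₁)

end Gabor

end GenGabor

/-! By density it suffices to treat a bounded measurable `f` with compact support. For fixed `i ∈
K₁`, unfolding the integral over `G` along `K₂` shows that the coefficients of `f` against `γ T_i
g`, `γ ∈ Ann(K₂)`, are the Fourier coefficients on `G ⧸ K₂` of the finite sum `φ_i(x) = ∑_k f(xk)
conj (g(x k i⁻¹))` (`inner_gaborSystem`). Parseval on `G ⧸ K₂` turns the frame sum into `|G/K₂| ∫
∑_i |φ_i(x)|² dx` (`tsum_enorm_inner_gaborSystem`).

At a fixed `x` the inner sum is a Hermitian form in the numbers `f(xk)`, with Gram entries given by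
the correlation of `g` at the coset of `xk` with shift `k l⁻¹`. Schur's test
(`abs_tsum_norm_sq_sub_le`, `pointwise_bounds`) compares the form with its diagonal. It therefore
lies between `∑_k |f(xk)|²` weighted by the bracket in `A` and the same sum weighted by the sum in
`B`, both taken at `xk`. Integrating `∑_k |f(xk)|²` over a fundamental set gives `‖f‖²`.

Parseval (`hasSum_norm_inner_charLp`) rests on totality of the characters: Hermitian convolution
operators are compact and self-adjoint, and their finite-dimensional eigenspaces for nonzero
eigenvalues are translation invariant, hence spanned by characters. No countability of `G` is
assumed. Sums over `K₁` are exchanged with integrals because an `L²` function meets only countably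
many translates of a compact set (`countable_setOf_mul_ne_zero`). -/

namespace GenGabor

set_option linter.unusedSectionVars false

/-! ### Joint eigenvectors in finite dimension -/

/-- A commuting family of endomorphisms has a common eigenvector in every nonzero invariant
finite-dimensional subspace. -/
theorem exists_common_eigenvector {E ι : Type*} [AddCommGroup E] [Module ℂ E]
    (U : ι → Module.End ℂ E) (hU : ∀ a b, Commute (U a) (U b)) (n : ℕ) :
    ∀ W : Submodule ℂ E, Module.finrank ℂ W = n → FiniteDimensional ℂ W → W ≠ ⊥ →
      (∀ a, ∀ w ∈ W, U a w ∈ W) → ∃ φ ∈ W, φ ≠ 0 ∧ ∀ a, ∃ c : ℂ, U a φ = c • φ := by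
  induction n using Nat.strong_induction_on with
  | _ n ih =>
    intro W hn hfin hW hinv
    -- If all operators are scalar on `W`, any nonzero vector serves. Otherwise a non-scalar one has
    -- a proper nonzero eigenspace in `W`, which the others preserve because they commute with it.
    by_cases hsc : ∀ a, ∃ c : ℂ, ∀ w ∈ W, U a w = c • w
    · obtain ⟨φ, hφ, hφ0⟩ := W.exists_mem_ne_zero_of_ne_bot hW
      exact ⟨φ, hφ, hφ0, fun a => (hsc a).imp fun c hc => hc φ hφ⟩
    · push Not at hsc
      obtain ⟨a, ha⟩ := hsc
      have : Nontrivial W := Submodule.nontrivial_iff_ne_bot.2 hW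
      obtain ⟨c, hc⟩ := Module.End.exists_eigenvalue ((U a).restrict (hinv a))
      obtain ⟨v, hv⟩ := hc.exists_hasEigenvector
      have hva : U a v = c • (v : E) := by
        simpa using congrArg Subtype.val hv.apply_eq_smul
      obtain ⟨w, hw, hwa⟩ := ha c
      let W' : Submodule ℂ E := W ⊓ Module.End.eigenspace (U a) c
      have hlt : W' < W := by
        refine lt_of_le_of_ne inf_le_left fun h => hwa ?_
        have hw' : w ∈ W' := by rw [h]; exact hw
        exact Module.End.mem_eigenspace_iff.1 hw'.2
      have hfin' : FiniteDimensional ℂ W' := Submodule.finiteDimensional_of_le hlt.le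
      obtain ⟨φ, hφ, h⟩ := ih _ (hn ▸ Submodule.finrank_lt_finrank_of_lt hlt) W' rfl hfin'
        (by
          refine W'.ne_bot_iff.2 ⟨v, ⟨v.2, Module.End.mem_eigenspace_iff.2 hva⟩, ?_⟩
          exact fun h => hv.2 (Subtype.ext h))
        (by
          rintro b w ⟨hw, hwc⟩
          refine ⟨hinv b w hw, Module.End.mem_eigenspace_iff.2 ?_⟩
          have h1 : U a (U b w) = U b (U a w) := congrArg (· w) (hU a b).eq
          rw [h1, Module.End.mem_eigenspace_iff.1 hwc, map_smul])
      exact ⟨φ, hφ.1, h⟩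

/-! ### Convolution operators and Parseval's identity on a compact abelian group -/

section CompactGroup

variable {Q : Type*} [CommGroup Q] [TopologicalSpace Q] [IsTopologicalGroup Q] [CompactSpace Q]
  [MeasurableSpace Q] [BorelSpace Q] (ν : Measure Q) [IsFiniteMeasure ν]

/-- The continuous family of functions `y ↦ conj (k (x y⁻¹))`, indexed by `x`. -/
noncomputable def convKernel (k : C(Q, ℂ)) : C(Q, C(Q, ℂ)) :=
  ContinuousMap.curry ⟨fun p : Q × Q => conj (k (p.1 * p.2⁻¹)), by fun_prop⟩

@[simp]
theorem convKernel_apply (k : C(Q, ℂ)) (x y : Q) : convKernel k x y = conj (k (x * y⁻¹)) := rfl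

/-- Convolution with a continuous function, as an operator from `L²(Q)` to `C(Q)`. -/
noncomputable def convMap (k : C(Q, ℂ)) : Lp ℂ 2 ν →L[ℂ] C(Q, ℂ) :=
  LinearMap.mkContinuous
    { toFun := fun f =>
        ⟨fun x => inner ℂ (ContinuousMap.toLp 2 ν ℂ (convKernel k x)) f, by fun_prop⟩
      map_add' := fun f g => by ext x; simp [inner_add_right]
      map_smul' := fun c f => by ext x; simp [inner_smul_right] }
    (‖(ContinuousMap.toLp 2 ν ℂ : C(Q, ℂ) →L[ℂ] Lp ℂ 2 ν)‖ * ‖convKernel k‖) (fun f => by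
      refine (ContinuousMap.norm_le _ (by positivity)).2 fun x => ?_
      refine (norm_inner_le_norm (𝕜 := ℂ) _ f).trans ?_
      gcongr
      exact (ContinuousLinearMap.le_opNorm _ _).trans
        (by gcongr; exact ContinuousMap.norm_coe_le_norm _ x))

theorem convMap_apply (k : C(Q, ℂ)) (f : Lp ℂ 2 ν) (x : Q) :
    convMap ν k f x = inner ℂ (ContinuousMap.toLp 2 ν ℂ (convKernel k x)) f := rfl

/-- Arzelà–Ascoli: since `x ↦ convKernel k x` is continuous into `L²`, Cauchy–Schwarz makes the
image of the unit ball equicontinuous and bounded. -/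
theorem isCompactOperator_convMap (k : C(Q, ℂ)) : IsCompactOperator (convMap ν k) := by
  rw [← ContinuousLinearMap.coe_coe,
    isCompactOperator_iff_image_closedBall_subset_compact _ zero_lt_one]
  let e := ContinuousMap.linearIsometryBoundedOfCompact Q ℂ ℂ
  let A : Set (BoundedContinuousFunction Q ℂ) :=
    (fun f => e (convMap ν k f)) '' Metric.closedBall 0 1
  have hA : IsCompact (closure A) := by
    refine BoundedContinuousFunction.arzela_ascoli
      (Metric.closedBall 0 ‖convMap ν k‖) (isCompact_closedBall _ _) A ?_ ?_
    · rintro _ x ⟨f, hf, rfl⟩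
      have h1 : ‖f‖ ≤ 1 := by simpa using hf
      have h2 : ‖convMap ν k f x‖ ≤ ‖convMap ν k‖ :=
        (ContinuousMap.norm_coe_le_norm _ x).trans
          (((convMap ν k).le_opNorm f).trans (mul_le_of_le_one_right (norm_nonneg _) h1))
      simpa [e] using h2
    · intro x
      rw [Metric.equicontinuousAt_iff_right]
      intro ε hε
      have hc : Continuous fun y : Q => (ContinuousMap.toLp 2 ν ℂ (convKernel k y) : Lp ℂ 2 ν) := by
        fun_prop
      filter_upwards [Metric.continuousAt_iff'.1 (hc.continuousAt (x := x)) ε hε] with y hy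
      rintro ⟨_, f, hf, rfl⟩
      have h1 : ‖f‖ ≤ 1 := by simpa using hf
      change dist (convMap ν k f x) (convMap ν k f y) < ε
      rw [dist_comm, dist_eq_norm, convMap_apply, convMap_apply, ← inner_sub_left]
      rw [dist_eq_norm] at hy
      exact ((norm_inner_le_norm (𝕜 := ℂ) _ f).trans
        (mul_le_of_le_one_right (norm_nonneg _) h1)).trans_lt hy
  refine ⟨e.symm '' closure A, hA.image e.symm.continuous, ?_⟩
  rintro _ ⟨f, hf, rfl⟩
  exact ⟨e (convMap ν k f), subset_closure ⟨f, hf, rfl⟩, e.symm_apply_apply _⟩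

/-- Convolution with a continuous function, as an operator on `L²(Q)`. -/
noncomputable def convOp (k : C(Q, ℂ)) : Lp ℂ 2 ν →L[ℂ] Lp ℂ 2 ν :=
  (ContinuousMap.toLp 2 ν ℂ : C(Q, ℂ) →L[ℂ] Lp ℂ 2 ν).comp (convMap ν k)

theorem isCompactOperator_convOp (k : C(Q, ℂ)) : IsCompactOperator (convOp ν k) :=
  (isCompactOperator_convMap ν k).clm_comp
    (ContinuousMap.toLp 2 ν ℂ : C(Q, ℂ) →L[ℂ] Lp ℂ 2 ν)

theorem convMap_toLp (k f : C(Q, ℂ)) (x : Q) :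
    convMap ν k (ContinuousMap.toLp 2 ν ℂ f) x = ∫ y, k (x * y⁻¹) * f y ∂ν := by
  rw [convMap_apply, ContinuousMap.inner_toLp]
  simp [mul_comm]

theorem isSymmetric_convOp [ν.WeaklyRegular] [R1Space Q] (k : C(Q, ℂ))
    (hk : ∀ x, k x⁻¹ = conj (k x)) : (convOp ν k : Lp ℂ 2 ν →ₗ[ℂ] Lp ℂ 2 ν).IsSymmetric := by
  intro f g
  simp only [ContinuousLinearMap.coe_coe]
  refine DenseRange.induction_on₂
    (p := fun f g : Lp ℂ 2 ν => inner ℂ (convOp ν k f) g = inner ℂ f (convOp ν k g))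
    (ContinuousMap.toLp_denseRange ℂ ν ℂ (p := 2) (by simp))
    (isClosed_eq (by fun_prop) (by fun_prop)) ?_ f g
  intro a b
  change inner ℂ (ContinuousMap.toLp 2 ν ℂ (convMap ν k _)) _ =
    inner ℂ _ (ContinuousMap.toLp 2 ν ℂ (convMap ν k _))
  rw [ContinuousMap.inner_toLp, ContinuousMap.inner_toLp]
  simp only [convMap_toLp, ← integral_conj, ← integral_const_mul, ← integral_mul_const]
  -- This form of Fubini needs only a continuous integrand of compact support, so `Q` need not be
  -- second countable.
  rw [integral_integral_swap_of_hasCompactSupport (by fun_prop)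
    (HasCompactSupport.of_compactSpace _)]
  refine integral_congr_ae (Filter.Eventually.of_forall fun x => ?_)
  refine integral_congr_ae (Filter.Eventually.of_forall fun y => ?_)
  simp only [map_mul, ← hk]
  rw [mul_inv_rev, inv_inv]
  ring

/-- Translation `f ↦ f (a ·)` on `L²(Q)`. -/
noncomputable def translation [ν.IsMulLeftInvariant] (a : Q) : Lp ℂ 2 ν →ₗᵢ[ℂ] Lp ℂ 2 ν :=
  Lp.compMeasurePreservingₗᵢ ℂ (a * ·) (measurePreserving_mul_left ν a)

theorem translation_toLp [ν.IsMulLeftInvariant] (a : Q) (f : C(Q, ℂ)) :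
    translation ν a (ContinuousMap.toLp 2 ν ℂ f) =
      ContinuousMap.toLp 2 ν ℂ (f.comp (ContinuousMap.mulLeft a)) := by
  refine Lp.ext ?_
  have h1 := Lp.coeFn_compMeasurePreserving (ContinuousMap.toLp 2 ν ℂ f)
    (measurePreserving_mul_left ν a)
  have h2 := (measurePreserving_mul_left ν a).quasiMeasurePreserving.ae_eq_comp
    (ContinuousMap.coeFn_toLp (p := 2) (𝕜 := ℂ) ν f)
  exact h1.trans (h2.trans (ContinuousMap.coeFn_toLp (p := 2) (𝕜 := ℂ) ν
    (f.comp (ContinuousMap.mulLeft a))).symm)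

theorem translation_mul [ν.IsMulLeftInvariant] (a b : Q) (f : Lp ℂ 2 ν) :
    translation ν (a * b) f = translation ν a (translation ν b f) := by
  refine Lp.ext ?_
  have h1 := Lp.coeFn_compMeasurePreserving f (measurePreserving_mul_left ν (a * b))
  have h2 := Lp.coeFn_compMeasurePreserving (translation ν b f) (measurePreserving_mul_left ν a)
  have h3 := (measurePreserving_mul_left ν a).quasiMeasurePreserving.ae_eq_comp
    (Lp.coeFn_compMeasurePreserving f (measurePreserving_mul_left ν b))
  refine h1.trans ((h2.trans (h3.trans ?_)).symm)
  refine Filter.Eventually.of_forall fun x => ?_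
  simp only [Function.comp_apply]
  rw [mul_comm a b, mul_assoc]

theorem translation_one [ν.IsMulLeftInvariant] (f : Lp ℂ 2 ν) : translation ν 1 f = f := by
  refine Lp.ext ((Lp.coeFn_compMeasurePreserving f (measurePreserving_mul_left ν 1)).trans ?_)
  exact Filter.Eventually.of_forall fun x => by simp

theorem inner_translation [ν.IsMulLeftInvariant] (a : Q) (f g : Lp ℂ 2 ν) :
    inner ℂ f (translation ν a g) = inner ℂ (translation ν a⁻¹ f) g := by
  rw [← (translation ν a).inner_map_map (translation ν a⁻¹ f), ← translation_mul, mul_inv_cancel,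
    translation_one]

theorem convMap_translation [ν.IsMulLeftInvariant] (k : C(Q, ℂ)) (a x : Q) (f : Lp ℂ 2 ν) :
    convMap ν k (translation ν a f) x = convMap ν k f (a * x) := by
  rw [convMap_apply, inner_translation, translation_toLp, convMap_apply]
  congr 2
  ext y
  simp [mul_comm, mul_left_comm, mul_assoc]

theorem convOp_translation [ν.IsMulLeftInvariant] (k : C(Q, ℂ)) (a : Q) (f : Lp ℂ 2 ν) :
    convOp ν k (translation ν a f) = translation ν a (convOp ν k f) := by
  change ContinuousMap.toLp 2 ν ℂ (convMap ν k _) =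
    translation ν a (ContinuousMap.toLp 2 ν ℂ (convMap ν k _))
  rw [translation_toLp]
  congr 1
  ext x
  exact convMap_translation ν k a x f

/-- A character, as a continuous function. -/
noncomputable def charFun (χ : PontryaginDual Q) : C(Q, ℂ) :=
  ⟨fun x => (χ x : ℂ), continuous_subtype_val.comp (map_continuous χ)⟩

@[simp]
theorem charFun_apply (χ : PontryaginDual Q) (x : Q) : charFun χ x = (χ x : ℂ) := rfl

/-- A character, as an element of `L²`. -/
noncomputable def charLp (χ : PontryaginDual Q) : Lp ℂ 2 ν := ContinuousMap.toLp 2 ν ℂ (charFun χ)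

/-- A joint eigenvector of all translations which is an eigenvector of a convolution operator
is a multiple of a character. -/
theorem mem_span_charLp [ν.IsMulLeftInvariant] (k : C(Q, ℂ)) {φ : Lp ℂ 2 ν} (hφ : φ ≠ 0) {l : ℂ}
    (hl : l ≠ 0) (hkφ : convOp ν k φ = l • φ) (h : ∀ a, ∃ c : ℂ, translation ν a φ = c • φ) :
    φ ∈ Submodule.span ℂ (Set.range (charLp ν)) := by
  choose c hc using h
  have hn : ∀ a, ‖c a‖ = 1 := by
    intro a
    have h1 : ‖translation ν a φ‖ = ‖φ‖ := (translation ν a).norm_map φ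
    rw [hc, norm_smul] at h1
    exact mul_eq_right₀ (norm_ne_zero_iff.2 hφ) |>.1 h1
  have hval : ∀ a, convMap ν k φ a = c a * convMap ν k φ 1 := by
    intro a
    have := convMap_translation ν k a 1 φ
    rw [hc, map_smul, mul_one] at this
    simpa using this.symm
  have h1 : convMap ν k φ 1 ≠ 0 := by
    intro h0
    have : convMap ν k φ = 0 := by
      ext a
      simp [hval a, h0]
    have h2 : convOp ν k φ = 0 := by
      change ContinuousMap.toLp 2 ν ℂ (convMap ν k φ) = 0
      rw [this, map_zero]
    rw [hkφ] at h2
    exact (smul_ne_zero hl hφ) h2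
  -- A convolution is a genuine continuous function, so the multiplier `c`, a priori only a function
  -- of `a`, inherits continuity from it.
  have hcc : Continuous c := by
    have : c = fun a => convMap ν k φ a / convMap ν k φ 1 := by
      ext a
      rw [hval a, mul_div_cancel_right₀ _ h1]
    rw [this]
    fun_prop
  have hmul : ∀ a b, c (a * b) = c a * c b := by
    intro a b
    have := translation_mul ν a b φ
    rw [hc, hc b, map_smul, hc, smul_smul, mul_comm (c b)] at this
    exact smul_left_injective ℂ hφ this
  have h1c : c 1 = 1 := by
    have := hc 1
    rw [translation_one] at this
    exact (smul_left_injective ℂ hφ (by simpa using this)).symm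
  let χ : Q →ₜ* Circle :=
    { toFun := fun a => ⟨c a, mem_sphere_zero_iff_norm.2 (hn a)⟩
      map_one' := Subtype.ext h1c
      map_mul' := fun a b => Subtype.ext (hmul a b)
      continuous_toFun := hcc.subtype_mk _ }
  have hχ : convMap ν k φ = convMap ν k φ 1 • charFun (χ : PontryaginDual Q) := by
    ext a
    rw [hval a, mul_comm]
    rfl
  have h2 : φ = (l⁻¹ * convMap ν k φ 1) • charLp ν (χ : PontryaginDual Q) := by
    rw [mul_smul]
    change φ = l⁻¹ • convMap ν k φ 1 • ContinuousMap.toLp 2 ν ℂ _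
    rw [← map_smul, ← hχ]
    change φ = l⁻¹ • convOp ν k φ
    rw [hkφ, inv_smul_smul₀ hl]
  rw [h2]
  exact Submodule.smul_mem _ _ (Submodule.subset_span ⟨_, rfl⟩)

theorem translation_mem_span_charLp [ν.IsMulLeftInvariant] (a : Q) {f : Lp ℂ 2 ν}
    (hf : f ∈ Submodule.span ℂ (Set.range (charLp ν))) :
    translation ν a f ∈ Submodule.span ℂ (Set.range (charLp ν)) := by
  induction hf using Submodule.span_induction with
  | mem f hf =>
    obtain ⟨χ, rfl⟩ := hf
    have : translation ν a (charLp ν χ) = (χ a : ℂ) • charLp ν χ := by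
      rw [charLp, translation_toLp, ← map_smul]
      congr 1
      ext x
      simp
    rw [this]
    exact Submodule.smul_mem _ _ (Submodule.subset_span ⟨_, rfl⟩)
  | zero => simp
  | add f g _ _ hf hg => rw [map_add]; exact Submodule.add_mem _ hf hg
  | smul c f _ hf => rw [map_smul]; exact Submodule.smul_mem _ _ hf

/-- The eigenspace `E` is finite-dimensional by compactness and translation invariant. So is the
part of `E` orthogonal to `E ⊓ V`, `V` being the span of the characters. Were that part nonzero, it
would contain a joint eigenvector of the translations; this lies in `V`, hence is orthogonal to
itself. -/
theorem eigenspace_convOp_le [ν.IsMulLeftInvariant] (k : C(Q, ℂ)) {l : ℂ} (hl : l ≠ 0) :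
    Module.End.eigenspace (convOp ν k : Lp ℂ 2 ν →ₗ[ℂ] Lp ℂ 2 ν) l ≤
      Submodule.span ℂ (Set.range (charLp ν)) := by
  set V := Submodule.span ℂ (Set.range (charLp ν))
  set E := Module.End.eigenspace (convOp ν k : Lp ℂ 2 ν →ₗ[ℂ] Lp ℂ 2 ν) l
  have hfin : FiniteDimensional ℂ E :=
    ContinuousLinearMap.finite_dimensional_eigenspace (isCompactOperator_convOp ν k) l hl
  have hE : ∀ a, ∀ f ∈ E, translation ν a f ∈ E := by
    intro a f hf
    have hf : convOp ν k f = l • f := Module.End.mem_eigenspace_iff.1 hf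
    refine Module.End.mem_eigenspace_iff.2 ?_
    change convOp ν k (translation ν a f) = _
    rw [convOp_translation, hf, map_smul]
  have hfin1 : FiniteDimensional ℂ (E ⊓ V : Submodule ℂ (Lp ℂ 2 ν)) :=
    Submodule.finiteDimensional_of_le inf_le_left
  set W : Submodule ℂ (Lp ℂ 2 ν) := (E ⊓ V)ᗮ ⊓ E
  have hfin2 : FiniteDimensional ℂ W := Submodule.finiteDimensional_of_le inf_le_right
  have hW : W = ⊥ := by
    by_contra hne
    obtain ⟨φ, hφ, hφ0, h⟩ := exists_common_eigenvector
      (fun a : Q => (translation ν a : Lp ℂ 2 ν →ₗ[ℂ] Lp ℂ 2 ν))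
      (by
        intro a b
        refine LinearMap.ext fun f => ?_
        change translation ν a (translation ν b f) = translation ν b (translation ν a f)
        rw [← translation_mul, ← translation_mul, mul_comm]) _ W rfl hfin2 hne
      (by
        rintro a f ⟨hf1, hf2⟩
        refine ⟨(Submodule.mem_orthogonal _ _).2 fun u hu => ?_, hE a f hf2⟩
        change inner ℂ u (translation ν a f) = 0
        rw [inner_translation]
        exact (Submodule.mem_orthogonal _ _).1 hf1 _
          ⟨hE _ _ hu.1, translation_mem_span_charLp ν _ hu.2⟩)
    have hV : φ ∈ V := mem_span_charLp ν k hφ0 hl (Module.End.mem_eigenspace_iff.1 hφ.2) h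
    exact hφ0 (inner_self_eq_zero.1 ((Submodule.mem_orthogonal _ _).1 hφ.1 φ ⟨hφ.2, hV⟩))
  have h := Submodule.sup_orthogonal_inf_of_hasOrthogonalProjection
    (inf_le_left : E ⊓ V ≤ E)
  change E ⊓ V ⊔ W = E at h
  rw [hW, sup_bot_eq] at h
  exact inf_eq_left.1 h

variable [ν.IsMulLeftInvariant] [ν.WeaklyRegular] [ν.IsOpenPosMeasure] [R1Space Q]

/-- By the spectral theorem it is enough to test `convOp ν k f` against eigenvectors `u`. Symmetry
moves the operator to `u`, and either the eigenvalue is `0` or `u` lies in the span of the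
characters. -/
theorem convOp_eq_zero_of_mem_orthogonal (k : C(Q, ℂ)) (hk : ∀ x, k x⁻¹ = conj (k x))
    {f : Lp ℂ 2 ν} (hf : f ∈ (Submodule.span ℂ (Set.range (charLp ν)))ᗮ) : convOp ν k f = 0 := by
  have hs := isSymmetric_convOp ν k hk
  have key := ContinuousLinearMap.orthogonalComplement_iSup_eigenspaces_eq_bot
    (isCompactOperator_convOp ν k) hs
  rw [← Submodule.mem_bot ℂ, ← key, Submodule.mem_orthogonal]
  intro u hu
  induction hu using Submodule.iSup_induction' with
  | mem l u hu =>
    have h1 : inner ℂ u (convOp ν k f) = inner ℂ (convOp ν k u) f := (hs u f).symm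
    have h2 : convOp ν k u = l • u := Module.End.mem_eigenspace_iff.1 hu
    rw [h1, h2, inner_smul_left]
    by_cases hl : l = 0
    · simp [hl]
    · rw [(Submodule.mem_orthogonal _ _).1 hf u (eigenspace_convOp_le ν k hl hu), mul_zero]
  | zero => simp
  | add u v _ _ hu hv => rw [inner_add_left, hu, hv, add_zero]

/-- With `k'(x) = conj (k x⁻¹)`, both `k + k'` and `i (k - k')` are Hermitian kernels, and `k` is a
combination of them. Positivity of `ν` on open sets upgrades vanishing in `L²` to vanishing
everywhere. -/
theorem convMap_eq_zero_of_mem_orthogonal (k : C(Q, ℂ)) {f : Lp ℂ 2 ν}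
    (hf : f ∈ (Submodule.span ℂ (Set.range (charLp ν)))ᗮ) : convMap ν k f = 0 := by
  have herm : ∀ k : C(Q, ℂ), (∀ x, k x⁻¹ = conj (k x)) → convMap ν k f = 0 := fun k hk =>
    (ContinuousMap.toLp_injective (p := 2) (𝕜 := ℂ) ν)
      ((convOp_eq_zero_of_mem_orthogonal ν k hk hf).trans (map_zero _).symm)
  let k' : C(Q, ℂ) := ⟨fun x => conj (k x⁻¹), by fun_prop⟩
  have h1 := herm (k + k') (fun x => by simp [k', add_comm])
  have h2 := herm (Complex.I • (k - k')) (fun x => by simp [k']; ring)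
  ext x
  have h1 := DFunLike.congr_fun h1 x
  have h2 := DFunLike.congr_fun h2 x
  have e1 : convMap ν (k + k') f x = convMap ν k f x + convMap ν k' f x := by
    simp only [convMap_apply, ← inner_add_left, ← map_add]
    congr 2
    ext; simp
  have e2 : convMap ν (Complex.I • (k - k')) f x =
      Complex.I * (convMap ν k f x - convMap ν k' f x) := by
    have : convKernel (Complex.I • (k - k')) x =
        (-Complex.I) • (convKernel k x - convKernel k' x) := by
      ext; simp
    simp only [convMap_apply, this, ← inner_sub_left, ← map_sub]
    rw [map_smul, inner_smul_left]
    simp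
  rw [e1] at h1
  rw [e2] at h2
  have h2 : convMap ν k f x - convMap ν k' f x = 0 := by simpa using h2
  have h1 : convMap ν k f x + convMap ν k' f x = 0 := by simpa using h1
  change convMap ν k f x = 0
  linear_combination (h1 + h2) / 2

/-- The characters of a compact abelian group are total in `L²`. -/
theorem orthogonal_span_charLp : (Submodule.span ℂ (Set.range (charLp ν)))ᗮ = ⊥ := by
  rw [Submodule.eq_bot_iff]
  intro f hf
  have h : ∀ g : Lp ℂ 2 ν, inner ℂ g f = 0 := by
    intro g
    refine DenseRange.induction_on (p := fun g : Lp ℂ 2 ν => inner ℂ g f = 0)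
      (ContinuousMap.toLp_denseRange ℂ ν ℂ (p := 2) (by simp)) g
      (isClosed_eq (by fun_prop) continuous_const) fun a => ?_
    -- Chosen so that the convolution evaluated at `1` is the inner product of `a` with `f`.
    let k : C(Q, ℂ) := ⟨fun x => conj (a x⁻¹), by fun_prop⟩
    have h1 := DFunLike.congr_fun (convMap_eq_zero_of_mem_orthogonal ν k hf) 1
    rw [convMap_apply] at h1
    have : convKernel k 1 = a := by ext; simp [k]
    rwa [this] at h1
  exact inner_self_eq_zero.1 (h f)

/-- Translation by a point where the characters differ preserves the inner product, yet multiplies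
it by `conj (χ a) * χ' a ≠ 1`. -/
theorem inner_charLp_of_ne {χ χ' : PontryaginDual Q} (h : χ ≠ χ') :
    inner ℂ (charLp ν χ) (charLp ν χ') = 0 := by
  obtain ⟨a, ha⟩ := DFunLike.ne_iff.1 h
  have key : ∀ χ : PontryaginDual Q, translation ν a (charLp ν χ) = (χ a : ℂ) • charLp ν χ := by
    intro χ
    rw [charLp, translation_toLp, ← map_smul]
    congr 1
    ext x
    simp
  have h1 := (translation ν a).inner_map_map (charLp ν χ) (charLp ν χ')
  rw [key, key, inner_smul_left, inner_smul_right, ← mul_assoc] at h1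
  by_contra h0
  have h2 : conj (χ a : ℂ) * (χ' a : ℂ) = 1 := mul_right_cancel₀ h0 (by rw [h1, one_mul])
  refine ha (Subtype.ext ?_)
  have h3 : (χ a : ℂ) * conj (χ a : ℂ) = 1 := by
    rw [Complex.mul_conj, Circle.normSq_coe, Complex.ofReal_one]
  calc (χ a : ℂ) = (χ a : ℂ) * (conj (χ a : ℂ) * (χ' a : ℂ)) := by rw [h2, mul_one]
    _ = (χ' a : ℂ) := by rw [← mul_assoc, h3, one_mul]

theorem inner_charLp_self (χ : PontryaginDual Q) :
    inner ℂ (charLp ν χ) (charLp ν χ) = (ν.real Set.univ : ℂ) := by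
  rw [charLp, ContinuousMap.inner_toLp]
  simp [Complex.mul_conj]

/-- **Parseval's identity** for the characters of a compact abelian group. -/
theorem hasSum_norm_inner_charLp (f : Lp ℂ 2 ν) :
    HasSum (fun χ : PontryaginDual Q => ‖inner ℂ (charLp ν χ) f‖ ^ 2)
      (ν.real Set.univ * ‖f‖ ^ 2) := by
  have hpos : 0 < ν.real Set.univ := by
    rw [measureReal_def]
    exact ENNReal.toReal_pos (isOpen_univ.measure_ne_zero ν Set.univ_nonempty) (measure_ne_top _ _)
  set m := ν.real Set.univ
  -- Each character has squared norm equal to the total mass `m`, hence the normalising factor and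
  -- the factor `m` in the result.
  let e : PontryaginDual Q → Lp ℂ 2 ν := fun χ => ((Real.sqrt m)⁻¹ : ℂ) • charLp ν χ
  have he : Orthonormal ℂ e := by
    refine ⟨fun χ => ?_, fun χ χ' h => ?_⟩
    · have h1 : ‖charLp ν χ‖ ^ 2 = m := by
        have := inner_charLp_self ν χ
        rw [inner_self_eq_norm_sq_to_K] at this
        exact Complex.ofReal_injective (by push_cast; exact this)
      have h2 : ‖charLp ν χ‖ = Real.sqrt m := by
        rw [← h1, Real.sqrt_sq (norm_nonneg _)]
      simp only [e]
      rw [norm_smul, h2, norm_inv, Complex.norm_real, Real.norm_of_nonneg (Real.sqrt_nonneg _),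
        inv_mul_cancel₀ (Real.sqrt_pos.2 hpos).ne']
    · simp only [e]
      rw [inner_smul_left, inner_smul_right, inner_charLp_of_ne ν h]
      simp
  have hsp : (Submodule.span ℂ (Set.range e))ᗮ = ⊥ := by
    refine eq_bot_mono (Submodule.orthogonal_le ?_) (orthogonal_span_charLp ν)
    refine Submodule.span_le.2 ?_
    rintro _ ⟨χ, rfl⟩
    have : charLp ν χ = (Real.sqrt m : ℂ) • e χ := by
      simp only [e]
      rw [smul_inv_smul₀]
      exact_mod_cast (Real.sqrt_pos.2 hpos).ne'
    rw [this]
    exact Submodule.smul_mem _ _ (Submodule.subset_span ⟨χ, rfl⟩)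
  let b := HilbertBasis.mkOfOrthogonalEqBot he hsp
  have hb : ∀ χ, b χ = e χ := fun χ => by simp [b]
  have h1 := b.hasSum_inner_mul_inner f f
  simp only [hb] at h1
  have h2 : HasSum (fun χ => ‖inner ℂ (e χ) f‖ ^ 2) (‖f‖ ^ 2) := by
    have h3 := Complex.hasSum_re h1
    have e1 : (inner ℂ f f : ℂ).re = ‖f‖ ^ 2 := inner_self_eq_norm_sq (𝕜 := ℂ) f
    have e2 : ∀ χ, (inner ℂ f (e χ) * inner ℂ (e χ) f : ℂ).re = ‖inner ℂ (e χ) f‖ ^ 2 := by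
      intro χ
      have := inner_mul_symm_re_eq_norm (𝕜 := ℂ) f (e χ)
      rw [norm_mul, norm_inner_symm, ← sq] at this
      exact this
    simpa only [e1, e2] using h3
  have e3 : ∀ χ, m * ‖inner ℂ (e χ) f‖ ^ 2 = ‖inner ℂ (charLp ν χ) f‖ ^ 2 := by
    intro χ
    simp only [e]
    rw [inner_smul_left, norm_mul, mul_pow]
    simp only [map_inv₀, Complex.conj_ofReal, norm_inv, Complex.norm_real]
    rw [Real.norm_of_nonneg (Real.sqrt_nonneg _), inv_pow, Real.sq_sqrt hpos.le, ← mul_assoc,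
      mul_inv_cancel₀ hpos.ne', one_mul]
  simpa only [e3] using h2.mul_left m

end CompactGroup

theorem eLpNorm_two_sq {α : Type*} [MeasurableSpace α] (μ : Measure α) (f : α → ℂ) :
    eLpNorm f 2 μ ^ 2 = ∫⁻ x, ‖f x‖ₑ ^ 2 ∂μ := by
  have := eLpNorm_nnreal_pow_eq_lintegral (f := f) (μ := μ) (p := 2) two_ne_zero
  simpa using this

/-! ### Discrete subgroups and the Borel structure of the quotient -/

section Lattices

variable {G : Type*} [CommGroup G] [TopologicalSpace G] [IsTopologicalGroup G]

/-- Such `k` lie in the compact set `D⁻¹C`, which meets the closed discrete subgroup in a finite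
set. -/
theorem exists_finset_mul_mem [T2Space G] {K : Subgroup G} [DiscreteTopology K] {D C : Set G}
    (hD : IsCompact D) (hC : IsCompact C) :
    ∃ S : Finset K, ∀ x ∈ D, ∀ k : K, x * k ∈ C → k ∈ S := by
  have h1 : IsCompact ((fun p : G × G => p.1⁻¹ * p.2) '' (D ×ˢ C)) :=
    (hD.prod hC).image (by fun_prop)
  have h2 : Topology.IsClosedEmbedding (Subtype.val : K → G) :=
    (Subgroup.isClosed_of_discrete (H := K)).isClosedEmbedding_subtypeVal
  have h3 := (h2.isCompact_preimage h1).finite_of_discrete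
  refine ⟨h3.toFinset, fun x hx k hxk => ?_⟩
  rw [Set.Finite.mem_toFinset]
  exact ⟨(x, x * k), ⟨hx, hxk⟩, by simp⟩

/-- The quotient map by a discrete subgroup is locally injective. -/
theorem exists_isOpen_mem_injOn_mk (K : Subgroup G) [DiscreteTopology K] (a : G) :
    ∃ V : Set G, IsOpen V ∧ a ∈ V ∧ ∀ x ∈ V, ∀ y ∈ V, x⁻¹ * y ∈ K → x = y := by
  obtain ⟨U, hUo, hU⟩ : ∃ U : Set G, IsOpen U ∧ Subtype.val ⁻¹' U = ({1} : Set K) := by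
    have := isOpen_discrete ({1} : Set K)
    rwa [isOpen_induced_iff] at this
  have hU1 : (1 : G) ∈ U := by
    have : (1 : K) ∈ (Subtype.val ⁻¹' U : Set K) := by rw [hU]; rfl
    exact this
  have hc : Continuous (fun p : G × G => p.1⁻¹ * p.2) := by fun_prop
  have hn : (fun p : G × G => p.1⁻¹ * p.2) ⁻¹' U ∈ nhds (a, a) :=
    hc.continuousAt.preimage_mem_nhds (hUo.mem_nhds (by simpa using hU1))
  rw [nhds_prod_eq, Filter.mem_prod_self_iff] at hn
  obtain ⟨t, ht, htU⟩ := hn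
  obtain ⟨V, hVt, hVo, hV1⟩ := mem_nhds_iff.1 ht
  refine ⟨V, hVo, hV1, fun x hx y hy hxy => ?_⟩
  have h1 : (⟨x⁻¹ * y, hxy⟩ : K) ∈ (Subtype.val ⁻¹' U : Set K) :=
    htU (Set.mk_mem_prod (hVt hx) (hVt hy))
  rw [hU] at h1
  exact inv_mul_eq_one.1 (congrArg Subtype.val (Set.mem_singleton_iff.1 h1))

variable [MeasurableSpace G] [BorelSpace G]

/-- Finitely many open sets on which the quotient map is an open embedding cover `D`; on each of
them images of measurable sets are Borel. -/
theorem measurableSet_borel_image_mk (K : Subgroup G) [DiscreteTopology K] {B D : Set G}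
    (hB : MeasurableSet B) (hD : IsCompact D) (hBD : B ⊆ D) :
    MeasurableSet[borel (G ⧸ K)] ((QuotientGroup.mk : G → G ⧸ K) '' B) := by
  let _ : MeasurableSpace (G ⧸ K) := borel _
  have : BorelSpace (G ⧸ K) := ⟨rfl⟩
  choose V hVo hVa hVi using exists_isOpen_mem_injOn_mk K
  obtain ⟨t, ht⟩ := hD.elim_finite_subcover V hVo
    (fun x _ => Set.mem_iUnion.2 ⟨x, hVa x⟩)
  have key : ∀ a, MeasurableSet ((QuotientGroup.mk : G → G ⧸ K) '' (B ∩ V a)) := by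
    intro a
    let e : V a → G ⧸ K := fun x => QuotientGroup.mk (x : G)
    have he : Topology.IsOpenEmbedding e := by
      refine .of_continuous_injective_isOpenMap
        (QuotientGroup.continuous_mk.comp continuous_subtype_val) ?_ ?_
      · intro x y h
        exact Subtype.ext (hVi a _ x.2 _ y.2 (QuotientGroup.eq.1 h))
      · exact (QuotientGroup.isOpenMap_coe).comp (hVo a).isOpenMap_subtype_val
    have : (QuotientGroup.mk : G → G ⧸ K) '' (B ∩ V a) = e '' (Subtype.val ⁻¹' B) := by
      ext q
      constructor
      · rintro ⟨x, ⟨hx, hxV⟩, rfl⟩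
        exact ⟨⟨x, hxV⟩, hx, rfl⟩
      · rintro ⟨x, hx, rfl⟩
        exact ⟨x, ⟨hx, x.2⟩, rfl⟩
    rw [this]
    exact he.measurableEmbedding.measurableSet_image.2 (measurable_subtype_coe hB)
  have : (QuotientGroup.mk : G → G ⧸ K) '' B = ⋃ a ∈ t, QuotientGroup.mk '' (B ∩ V a) := by
    rw [← Set.image_iUnion₂, ← Set.inter_iUnion₂, Set.inter_eq_left.2 (hBD.trans ht)]
  rw [this]
  exact t.measurableSet_biUnion fun a _ => key a

/-- The given σ-algebra on `G ⧸ K` is the quotient one. A set measurable for it is the image of its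
preimage cut down to a relatively compact fundamental set, hence Borel. -/
theorem IsUniformLattice.borelSpace [LocallyCompactSpace G] {K : Subgroup G}
    (hK : IsUniformLattice K) : BorelSpace (G ⧸ K) := by
  have := hK.discrete
  obtain ⟨F, hF⟩ := hK.exists_isFundamentalSet
  obtain ⟨D, hD, hFD⟩ := hF.relCompact
  constructor
  refine le_antisymm (fun B hB => ?_) ?_
  · have hB' : MeasurableSet ((QuotientGroup.mk : G → G ⧸ K) ⁻¹' B) := hB
    have h := measurableSet_borel_image_mk K (hB'.inter hF.measurable) hD
      (Set.inter_subset_right.trans hFD)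
    convert h
    ext q
    constructor
    · intro hq
      obtain ⟨x, rfl⟩ := QuotientGroup.mk_surjective q
      obtain ⟨k, hk, hxk⟩ := hF.covers x
      have h1 : (QuotientGroup.mk (x * k) : G ⧸ K) = QuotientGroup.mk x :=
        QuotientGroup.mk_mul_of_mem x hk
      exact ⟨x * k, ⟨by rw [Set.mem_preimage, h1]; exact hq, hxk⟩, h1⟩
    · rintro ⟨x, ⟨hx, -⟩, rfl⟩
      exact hx
  · exact MeasurableSpace.generateFrom_le fun B hB =>
      (hB.preimage QuotientGroup.continuous_mk).measurableSet

/-! ### Unfolding integrals over a fundamental set -/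

section Fundamental

variable {K : Subgroup G} {F : Set G} (μ : Measure G) [μ.IsHaarMeasure]

/-- The translates of a fundamental set are disjoint. -/
theorem IsFundamentalSet.pairwiseDisjoint (hF : IsFundamentalSet K F) (S : Set K) :
    S.PairwiseDisjoint fun k : K => (fun x => x * (k : G)⁻¹) ⁻¹' F := by
  intro a _ b _ hab
  refine Set.disjoint_left.2 fun x hxa hxb => hab ?_
  have := hF.injective _ hxa _ hxb (by
    have : (x * (a : G)⁻¹)⁻¹ * (x * (b : G)⁻¹) = a * (b : G)⁻¹ := by group
    rw [this]
    exact K.mul_mem a.2 (K.inv_mem b.2))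
  exact Subtype.ext (inv_injective (mul_left_cancel this))

/-- As an identity of measures it yields the unfolding of both kinds of integral, for `lintegral`
without any measurability of the integrand. -/
theorem IsFundamentalSet.restrict_eq_sum (hF : IsFundamentalSet K F) (S : Finset K) :
    μ.restrict (⋃ k ∈ S, (fun x => x * (k : G)⁻¹) ⁻¹' F) =
      ∑ k ∈ S, (μ.restrict F).map (· * (k : G)) := by
  have hm : ∀ k : K, MeasurableSet ((fun x => x * (k : G)⁻¹) ⁻¹' F) := fun k =>
    hF.measurable.preimage (by fun_prop)
  rw [Measure.restrict_biUnion_finset (hF.pairwiseDisjoint _) hm, Measure.sum_fintype]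
  rw [← Finset.sum_coe_sort S]
  refine Finset.sum_congr rfl fun k _ => ?_
  have h := (measurePreserving_mul_right μ (k : G)).restrict_preimage
    (hm k)
  rw [← h.map_eq]
  congr 2
  ext x
  simp

theorem IsFundamentalSet.mem_iUnion (hF : IsFundamentalSet K F) {S : Finset K} {C : Set G}
    (hS : ∀ x ∈ F, ∀ k : K, x * k ∈ C → k ∈ S) {x : G} (hx : x ∈ C) :
    x ∈ ⋃ k ∈ S, (fun x => x * (k : G)⁻¹) ⁻¹' F := by
  obtain ⟨k, hk, hxk⟩ := hF.covers x
  exact Set.mem_iUnion₂.2 ⟨⟨k⁻¹, K.inv_mem hk⟩, hS _ hxk _ (by simpa using hx), by simpa using hxk⟩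

/-- Unfolding over finitely many translates of a fundamental set. -/
theorem IsFundamentalSet.lintegral_eq_sum (hF : IsFundamentalSet K F) {S : Finset K} {C : Set G}
    (hS : ∀ x ∈ F, ∀ k : K, x * k ∈ C → k ∈ S) {h : G → ℝ≥0∞} (hh : ∀ x ∉ C, h x = 0) :
    ∫⁻ x, h x ∂μ = ∑ k ∈ S, ∫⁻ x in F, h (x * k) ∂μ := by
  rw [← setLIntegral_eq_of_support_subset (s := ⋃ k ∈ S, (fun x => x * (k : G)⁻¹) ⁻¹' F),
    hF.restrict_eq_sum μ, lintegral_finsetSum_measure]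
  · exact Finset.sum_congr rfl fun k _ => (measurableEmbedding_mulRight (k : G)).lintegral_map _
  · intro x hx
    refine hF.mem_iUnion hS ?_
    by_contra hxC
    exact hx (hh x hxC)

theorem IsFundamentalSet.integral_eq_sum (hF : IsFundamentalSet K F) {S : Finset K} {C : Set G}
    (hS : ∀ x ∈ F, ∀ k : K, x * k ∈ C → k ∈ S) {h : G → ℂ} (hh : ∀ x ∉ C, h x = 0)
    (hi : Integrable h μ) :
    ∫ x, h x ∂μ = ∑ k ∈ S, ∫ x in F, h (x * k) ∂μ := by
  have hi' := hi.restrict (s := ⋃ k ∈ S, (fun x => x * (k : G)⁻¹) ⁻¹' F)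
  rw [hF.restrict_eq_sum μ, integrable_finsetSum_measure] at hi'
  rw [← setIntegral_eq_integral_of_forall_compl_eq_zero
    (s := ⋃ k ∈ S, (fun x => x * (k : G)⁻¹) ⁻¹' F), hF.restrict_eq_sum μ,
    integral_finsetSum_measure hi']
  · exact Finset.sum_congr rfl fun k _ => (measurableEmbedding_mulRight (k : G)).integral_map _
  · intro x hx
    exact hh x fun hxC => hx (hF.mem_iUnion hS hxC)

theorem IsFundamentalSet.measure_lt_top (hF : IsFundamentalSet K F) : μ F < ⊤ := by
  obtain ⟨D, hD, hFD⟩ := hF.relCompact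
  exact (measure_mono hFD).trans_lt hD.measure_lt_top

variable [T2Space G] [DiscreteTopology K]

theorem IsFundamentalSet.exists_finset (hF : IsFundamentalSet K F) {C : Set G} (hC : IsCompact C) :
    ∃ S : Finset K, ∀ x ∈ F, ∀ k : K, x * k ∈ C → k ∈ S := by
  obtain ⟨D, hD, hFD⟩ := hF.relCompact
  obtain ⟨S, hS⟩ := exists_finset_mul_mem (K := K) hD hC
  exact ⟨S, fun x hx => hS x (hFD hx)⟩

/-- If `F` were null, unfolding would make a compact neighbourhood of `1` null. -/
theorem IsFundamentalSet.measure_ne_zero [LocallyCompactSpace G] (hF : IsFundamentalSet K F) :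
    μ F ≠ 0 := by
  intro h0
  obtain ⟨C, hC, hC1⟩ := exists_compact_mem_nhds (1 : G)
  obtain ⟨S, hS⟩ := hF.exists_finset hC
  have h1 : ∫⁻ x, C.indicator 1 x ∂μ = 0 := by
    rw [hF.lintegral_eq_sum μ hS fun x hx => Set.indicator_of_notMem hx _,
      Measure.restrict_eq_zero.2 h0]
    simp
  rw [lintegral_indicator_one hC.measurableSet] at h1
  exact (Measure.measure_pos_of_mem_nhds μ hC1).ne' h1

/-- Unfold the indicator of `F' ∩ P` over `F`: exactly one translate of each `x` lies in `F'`, and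
it lies in `P` exactly when `x` does. This independence of the fundamental set gives invariance of
the quotient measure. -/
theorem IsFundamentalSet.measure_inter_eq {F' : Set G} (hF : IsFundamentalSet K F)
    (hF' : IsFundamentalSet K F') {P : Set G} (hP : MeasurableSet P)
    (hPK : ∀ x, ∀ k ∈ K, x * k ∈ P ↔ x ∈ P) : μ (F ∩ P) = μ (F' ∩ P) := by
  obtain ⟨C, hC, hFC⟩ := hF'.relCompact
  obtain ⟨S, hS⟩ := hF.exists_finset hC
  rw [← lintegral_indicator_one (hF'.measurable.inter hP), hF.lintegral_eq_sum μ hS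
    fun x hx => Set.indicator_of_notMem (fun h => hx (hFC h.1)) _]
  have hm : ∀ k : K, Measurable fun x : G => (F' ∩ P).indicator (1 : G → ℝ≥0∞) (x * k) := fun k =>
    (measurable_one.indicator (hF'.measurable.inter hP)).comp (measurable_mul_const (k : G))
  rw [← lintegral_finsetSum S fun k _ => hm k, Set.inter_comm F P,
    ← Measure.restrict_apply hP, ← lintegral_indicator_one hP]
  refine setLIntegral_congr_fun hF.measurable fun x hx => ?_
  obtain ⟨k, hk, hxk⟩ := hF'.covers x
  rw [Finset.sum_eq_single_of_mem (⟨k, hk⟩ : K) (hS x hx _ (hFC hxk))]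
  · by_cases hxP : x ∈ P
    · rw [Set.indicator_of_mem hxP, Set.indicator_of_mem]
      · rfl
      · exact ⟨hxk, (hPK x k hk).2 hxP⟩
    · rw [Set.indicator_of_notMem hxP, Set.indicator_of_notMem]
      exact fun h => hxP ((hPK x k hk).1 h.2)
  · intro l _ hl
    refine Set.indicator_of_notMem (fun h => hl ?_) _
    have := hF'.injective _ h.1 _ hxk (by
      have : (x * (l : G))⁻¹ * (x * k) = (l : G)⁻¹ * k := by group
      rw [this]
      exact K.mul_mem (K.inv_mem l.2) hk)
    exact Subtype.ext (mul_left_cancel this)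

end Fundamental

/-! ### Haar measure, characters and Parseval on `G ⧸ K` -/

section Quotient

variable [LocallyCompactSpace G] [T2Space G] (μ : Measure G) [μ.IsHaarMeasure]
  {K : Subgroup G} (hK : IsUniformLattice K)

theorem quotientMeasure_apply {B : Set (G ⧸ K)} (hB : MeasurableSet B) :
    quotientMeasure μ hK B = μ (fundamentalSet hK ∩ QuotientGroup.mk ⁻¹' B) := by
  have hB' : MeasurableSet ((QuotientGroup.mk : G → G ⧸ K) ⁻¹' B) := hB
  rw [quotientMeasure, Measure.map_apply QuotientGroup.measurable_coe hB,
    Measure.restrict_apply hB', Set.inter_comm]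

theorem quotientMeasure_univ : quotientMeasure μ hK Set.univ = μ (fundamentalSet hK) := by
  rw [quotientMeasure_apply μ hK MeasurableSet.univ, Set.preimage_univ, Set.inter_univ]

theorem isFiniteMeasure_quotientMeasure : IsFiniteMeasure (quotientMeasure μ hK) :=
  ⟨by
    rw [quotientMeasure_univ]
    exact (isFundamentalSet_fundamentalSet hK).measure_lt_top μ⟩

theorem IsFundamentalSet.preimage_mul_left {F : Set G} (hF : IsFundamentalSet K F) (a : G) :
    IsFundamentalSet K ((a * ·) ⁻¹' F) where
  measurable := hF.measurable.preimage (by fun_prop)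
  relCompact := by
    obtain ⟨D, hD, hFD⟩ := hF.relCompact
    refine ⟨(a⁻¹ * ·) '' D, hD.image (by fun_prop), fun x hx => ⟨a * x, hFD hx, by simp⟩⟩
  injective x hx y hy h :=
    mul_left_cancel (hF.injective _ hx _ hy (by simpa [mul_assoc] using h))
  covers x := by
    obtain ⟨k, hk, h⟩ := hF.covers (a * x)
    exact ⟨k, hk, by simpa [mul_assoc] using h⟩

/-- Translating a set in the quotient amounts to translating the fundamental set, which does not
affect the measure of `K`-invariant sets. -/
theorem isMulLeftInvariant_quotientMeasure : (quotientMeasure μ hK).IsMulLeftInvariant := by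
  have := hK.discrete
  have := hK.borelSpace
  have hF := isFundamentalSet_fundamentalSet hK
  refine ⟨fun q => Measure.ext fun B hB => ?_⟩
  obtain ⟨a, rfl⟩ := QuotientGroup.mk_surjective q
  have hm : Measurable fun x : G ⧸ K => (QuotientGroup.mk a : G ⧸ K) * x :=
    (continuous_const_mul _).measurable
  have hinv : ∀ x, ∀ k ∈ K, x * k ∈ (QuotientGroup.mk ⁻¹' B : Set G) ↔
      x ∈ (QuotientGroup.mk ⁻¹' B : Set G) := by
    intro x k hk
    have : (QuotientGroup.mk (x * k) : G ⧸ K) = QuotientGroup.mk x :=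
      QuotientGroup.mk_mul_of_mem x hk
    rw [Set.mem_preimage, Set.mem_preimage, this]
  rw [Measure.map_apply hm hB, quotientMeasure_apply μ hK (hm hB), quotientMeasure_apply μ hK hB,
    hF.measure_inter_eq μ (hF.preimage_mul_left a⁻¹) hB hinv,
    ← measure_preimage_mul μ a ((a⁻¹ * ·) ⁻¹' fundamentalSet hK ∩ QuotientGroup.mk ⁻¹' B)]
  congr 1
  ext x
  have : (QuotientGroup.mk (a * x) : G ⧸ K) = QuotientGroup.mk a * QuotientGroup.mk x := rfl
  simp only [Set.mem_inter_iff, Set.mem_preimage, inv_mul_cancel_left, this]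

variable [μ.Regular]

theorem innerRegularCompactLTTop_quotientMeasure :
    (quotientMeasure μ hK).InnerRegularCompactLTTop := by
  have := hK.borelSpace
  exact Measure.InnerRegularCompactLTTop.map_of_continuous QuotientGroup.continuous_mk

theorem isOpenPosMeasure_quotientMeasure : (quotientMeasure μ hK).IsOpenPosMeasure := by
  have := hK.discrete
  have := hK.borelSpace
  have := isMulLeftInvariant_quotientMeasure μ hK
  have := isFiniteMeasure_quotientMeasure μ hK
  have := innerRegularCompactLTTop_quotientMeasure μ hK
  have : NeZero (quotientMeasure μ hK) := ⟨fun h => by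
    have := quotientMeasure_univ μ hK
    rw [h] at this
    exact (isFundamentalSet_fundamentalSet hK).measure_ne_zero μ this.symm⟩
  infer_instance

/-- The point of the fundamental set which represents a given coset. -/
noncomputable def representative (q : G ⧸ K) : G :=
  q.out * ((isFundamentalSet_fundamentalSet hK).covers q.out).choose

theorem representative_mem (q : G ⧸ K) : representative hK q ∈ fundamentalSet hK :=
  ((isFundamentalSet_fundamentalSet hK).covers q.out).choose_spec.2

theorem mk_representative (q : G ⧸ K) : (QuotientGroup.mk (representative hK q) : G ⧸ K) = q := by
  rw [representative,
    QuotientGroup.mk_mul_of_mem _ ((isFundamentalSet_fundamentalSet hK).covers q.out).choose_spec.1]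
  exact QuotientGroup.out_eq' q

theorem representative_mk {x : G} (hx : x ∈ fundamentalSet hK) :
    representative hK (QuotientGroup.mk x) = x :=
  (isFundamentalSet_fundamentalSet hK).injective _ (representative_mem hK _) _ hx
    (QuotientGroup.eq.1 (mk_representative hK _))

/-- The preimage of `B` is the image of `fundamentalSet hK ∩ B` under the quotient map. -/
theorem measurable_representative : Measurable (representative hK) := by
  have := hK.discrete
  have := hK.borelSpace
  have hF := isFundamentalSet_fundamentalSet hK
  obtain ⟨D, hD, hFD⟩ := hF.relCompact
  intro B hB
  have h := measurableSet_borel_image_mk K (hF.measurable.inter hB) hD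
    (Set.inter_subset_left.trans hFD)
  rw [← BorelSpace.measurable_eq (α := G ⧸ K)] at h
  convert h
  ext q
  constructor
  · intro hq
    exact ⟨_, ⟨representative_mem hK q, hq⟩, mk_representative hK q⟩
  · rintro ⟨x, ⟨hx, hxB⟩, rfl⟩
    rw [Set.mem_preimage, representative_mk hK hx]
    exact hxB

theorem measurePreserving_representative :
    MeasurePreserving (representative hK) (quotientMeasure μ hK)
      (μ.restrict (fundamentalSet hK)) := by
  refine ⟨measurable_representative hK, ?_⟩
  rw [quotientMeasure, Measure.map_map (measurable_representative hK) QuotientGroup.measurable_coe]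
  refine (Measure.map_congr ?_).trans Measure.map_id
  refine (ae_restrict_iff' (isFundamentalSet_fundamentalSet hK).measurable).2 ?_
  exact Filter.Eventually.of_forall fun x hx => representative_mk hK hx

/-- The characters of `G ⧸ K` are the elements of the annihilator of `K`. -/
noncomputable def dualQuotientEquiv (K : Subgroup G) :
    PontryaginDual (G ⧸ K) ≃ annihilator K where
  toFun χ := ⟨(show G →ₜ* Circle from
    { toFun := fun x => χ (QuotientGroup.mk x)
      map_one' := map_one χ
      map_mul' := fun x y => map_mul χ (QuotientGroup.mk x) (QuotientGroup.mk y)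
      continuous_toFun := (map_continuous χ).comp QuotientGroup.continuous_mk }), fun k hk => by
        change χ (QuotientGroup.mk k) = 1
        rw [(QuotientGroup.eq_one_iff k).2 hk, map_one]⟩
  invFun γ := show (G ⧸ K) →ₜ* Circle from
    { QuotientGroup.lift K (MonoidHomClass.toMonoidHom (γ : PontryaginDual G)) γ.2 with
      continuous_toFun := (map_continuous (γ : PontryaginDual G)).quotient_lift _ }
  left_inv χ := by
    refine PontryaginDual.ext fun q => ?_
    obtain ⟨x, rfl⟩ := QuotientGroup.mk_surjective q
    rfl
  right_inv γ := Subtype.ext (PontryaginDual.ext fun x => rfl)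

theorem dualQuotientEquiv_apply (χ : PontryaginDual (G ⧸ K)) (x : G) :
    (dualQuotientEquiv K χ : PontryaginDual G) x = χ (QuotientGroup.mk x) := rfl

/-- **Parseval's identity** on a fundamental set of a uniform lattice. -/
theorem tsum_enorm_integral_annihilator {φ : G → ℂ}
    (hφ : MemLp φ 2 (μ.restrict (fundamentalSet hK))) :
    ∑' γ : annihilator K,
        ‖∫ x in fundamentalSet hK, conj ((γ : PontryaginDual G) x : ℂ) * φ x ∂μ‖ₑ ^ 2 =
      quotientMeasure μ hK Set.univ * ∫⁻ x in fundamentalSet hK, ‖φ x‖ₑ ^ 2 ∂μ := by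
  have := hK.discrete
  have := hK.cocompact
  have := hK.borelSpace
  have := isMulLeftInvariant_quotientMeasure μ hK
  have := isFiniteMeasure_quotientMeasure μ hK
  have := innerRegularCompactLTTop_quotientMeasure μ hK
  have := isOpenPosMeasure_quotientMeasure μ hK
  set ν := quotientMeasure μ hK
  have hs := measurePreserving_representative μ hK
  -- Composition with the measure-preserving section moves `φ` to the quotient, where Parseval for a
  -- compact group applies.
  have hψ := hφ.comp_measurePreserving hs
  have key := hasSum_norm_inner_charLp ν (hψ.toLp _)
  have h1 : ∀ χ : PontryaginDual (G ⧸ K), inner ℂ (charLp ν χ) (hψ.toLp _) =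
      ∫ x in fundamentalSet hK,
        conj ((dualQuotientEquiv K χ : PontryaginDual G) x : ℂ) * φ x ∂μ := by
    intro χ
    have hc : Continuous fun x : G => conj ((dualQuotientEquiv K χ : PontryaginDual G) x : ℂ) :=
      Complex.continuous_conj.comp (continuous_subtype_val.comp (map_continuous _))
    rw [L2.inner_def, ← hs.map_eq, integral_map hs.aemeasurable
      (by rw [hs.map_eq]; exact hc.aestronglyMeasurable.mul hφ.1)]
    refine integral_congr_ae ?_
    filter_upwards [hψ.coeFn_toLp, ContinuousMap.coeFn_toLp (p := 2) (𝕜 := ℂ) ν (charFun χ)]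
      with q hq1 hq2
    rw [hq1, charLp, hq2, RCLike.inner_apply, dualQuotientEquiv_apply, mk_representative, mul_comm]
    rfl
  have h2 : ENNReal.ofReal (‖hψ.toLp _‖ ^ 2) = ∫⁻ x in fundamentalSet hK, ‖φ x‖ₑ ^ 2 ∂μ := by
    rw [Lp.norm_toLp, ← ENNReal.toReal_pow, eLpNorm_comp_measurePreserving hφ.1 hs,
      ENNReal.ofReal_toReal (ENNReal.pow_ne_top hφ.2.ne), eLpNorm_two_sq]
  rw [← (dualQuotientEquiv K).tsum_eq, ← h2, ← ofReal_measureReal,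
    ← ENNReal.ofReal_mul measureReal_nonneg, ← key.tsum_eq,
    ENNReal.ofReal_tsum_of_nonneg (fun _ => by positivity) key.summable]
  refine tsum_congr fun χ => ?_
  rw [← h1, ENNReal.ofReal_pow (norm_nonneg _), ofReal_norm]

end Quotient

end Lattices

/-! ### Schur's test and pointwise estimates -/

theorem summable_mul_conj {ι : Type*} {u v : ι → ℂ} (hu : Summable fun i => ‖u i‖ ^ 2)
    (hv : Summable fun i => ‖v i‖ ^ 2) : Summable fun i => u i * conj (v i) := by
  refine Summable.of_norm_bounded (hu.add hv) fun i => ?_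
  rw [norm_mul, RCLike.norm_conj]
  nlinarith [sq_nonneg (‖u i‖ - ‖v i‖), sq_nonneg (‖u i‖), sq_nonneg ‖v i‖]

/-- Schur's test for the Gram matrix of finitely many square summable families. -/
theorem abs_tsum_norm_sq_sub_le {ι κ : Type*} [DecidableEq κ] (S : Finset κ) (a : κ → ℂ)
    (r : κ → ι → ℂ) (hr : ∀ k ∈ S, Summable fun i => ‖r k i‖ ^ 2) :
    Summable (fun i => ‖∑ k ∈ S, a k * conj (r k i)‖ ^ 2) ∧
    |∑' i, ‖∑ k ∈ S, a k * conj (r k i)‖ ^ 2 - ∑ k ∈ S, ‖a k‖ ^ 2 * ∑' i, ‖r k i‖ ^ 2| ≤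
      ∑ k ∈ S, ‖a k‖ ^ 2 * ∑ l ∈ S.erase k, ‖∑' i, r k i * conj (r l i)‖ := by
  set c : κ → κ → ℂ := fun k l => ∑' i, r k i * conj (r l i) with hc
  have hsum : HasSum (fun i => ((‖∑ k ∈ S, a k * conj (r k i)‖ ^ 2 : ℝ) : ℂ))
      (∑ k ∈ S, ∑ l ∈ S, a k * conj (a l) * c l k) := by
    have h1 : ∀ i, ((‖∑ k ∈ S, a k * conj (r k i)‖ ^ 2 : ℝ) : ℂ) =
        ∑ k ∈ S, ∑ l ∈ S, a k * conj (a l) * (r l i * conj (r k i)) := by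
      intro i
      rw [Complex.ofReal_pow, ← Complex.mul_conj', map_sum, Finset.sum_mul_sum]
      refine Finset.sum_congr rfl fun k _ => Finset.sum_congr rfl fun l _ => ?_
      simp only [map_mul, Complex.conj_conj]
      ring
    simp only [h1]
    exact hasSum_sum fun k hk => hasSum_sum fun l hl =>
      ((summable_mul_conj (hr l hl) (hr k hk)).hasSum).mul_left _
  have hdiag : ∀ k ∈ S, a k * conj (a k) * c k k = ((‖a k‖ ^ 2 * ∑' i, ‖r k i‖ ^ 2 : ℝ) : ℂ) := by
    intro k _
    simp only [hc, Complex.mul_conj']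
    push_cast
    rfl
  have hsymm : ∀ k l, ‖c l k‖ = ‖c k l‖ := by
    intro k l
    rw [← RCLike.norm_conj, hc]
    simp only [Complex.conj_tsum, map_mul, Complex.conj_conj]
    simp only [mul_comm]
  refine ⟨Complex.summable_ofReal.1 hsum.summable, ?_⟩
  rw [← Real.norm_eq_abs, ← Complex.norm_real, Complex.ofReal_sub, Complex.ofReal_tsum,
    hsum.tsum_eq,
    Complex.ofReal_sum, ← Finset.sum_congr rfl hdiag, ← Finset.sum_sub_distrib]
  have h2 : ∀ k ∈ S, (∑ l ∈ S, a k * conj (a l) * c l k) - a k * conj (a k) * c k k =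
      ∑ l ∈ S.erase k, a k * conj (a l) * c l k := fun k hk => by
    rw [← Finset.add_sum_erase S _ hk, add_sub_cancel_left]
  rw [Finset.sum_congr rfl h2]
  have herase : ∀ p : κ → κ → ℝ, ∑ k ∈ S, ∑ l ∈ S.erase k, p k l =
      ∑ k ∈ S, ∑ l ∈ S.erase k, p l k := by
    intro p
    refine Finset.sum_comm' fun k l => ?_
    simp only [Finset.mem_erase]
    tauto
  -- AM–GM on `‖a k‖ * ‖a l‖`, with the symmetry of `‖c k l‖`, splits each term in two halves;
  -- exchanging `k` and `l` in the second makes them equal.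
  calc ‖∑ k ∈ S, ∑ l ∈ S.erase k, a k * conj (a l) * c l k‖
      ≤ ∑ k ∈ S, ∑ l ∈ S.erase k, (‖a k‖ ^ 2 * ‖c k l‖ / 2 + ‖a l‖ ^ 2 * ‖c l k‖ / 2) := by
        refine (norm_sum_le _ _).trans (Finset.sum_le_sum fun k _ => ?_)
        refine (norm_sum_le _ _).trans (Finset.sum_le_sum fun l _ => ?_)
        rw [norm_mul, norm_mul, RCLike.norm_conj, hsymm k l]
        nlinarith [mul_nonneg (sq_nonneg (‖a k‖ - ‖a l‖)) (norm_nonneg (c k l))]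
    _ = ∑ k ∈ S, ‖a k‖ ^ 2 * ∑ l ∈ S.erase k, ‖c k l‖ := by
        simp only [Finset.sum_add_distrib]
        rw [herase fun k l => ‖a l‖ ^ 2 * ‖c l k‖ / 2, ← Finset.sum_add_distrib]
        refine Finset.sum_congr rfl fun k _ => ?_
        rw [← Finset.sum_add_distrib, Finset.mul_sum]
        exact Finset.sum_congr rfl fun l _ => add_halves _

section Pointwise

variable {G : Type*} [CommGroup G] [TopologicalSpace G] [IsTopologicalGroup G]
  [MeasurableSpace G] [BorelSpace G]

theorem correlation_mk (K : Subgroup G) (g : G → ℂ) (k x : G) :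
    correlation K g k (QuotientGroup.mk x) =
      ∑' i : K, g (x * (i : G)⁻¹) * conj (g (x * (i : G)⁻¹ * k⁻¹)) := rfl

theorem diagonal_mk (K : Subgroup G) (g : G → ℂ) (x : G) :
    diagonal K g (QuotientGroup.mk x) = ∑' i : K, ‖g (x * (i : G)⁻¹)‖ ^ 2 := rfl

theorem norm_correlation_one (K : Subgroup G) (g : G → ℂ) (q : G ⧸ K) :
    ‖correlation K g 1 q‖ = diagonal K g q := by
  obtain ⟨x, rfl⟩ := QuotientGroup.mk_surjective q
  rw [correlation_mk, diagonal_mk]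
  simp only [inv_one, mul_one, Complex.mul_conj', ← Complex.ofReal_pow]
  rw [← Complex.ofReal_tsum, Complex.norm_real, Real.norm_of_nonneg]
  exact tsum_nonneg fun _ => by positivity

theorem tsum_norm_correlation (K₁ K₂ : Subgroup G) (g : G → ℂ) (q : G ⧸ K₁)
    (h : Summable fun k : K₂ => ‖correlation K₁ g (k : G) q‖) :
    ∑' k : K₂, ‖correlation K₁ g (k : G) q‖ =
      diagonal K₁ g q + ∑' k : {k : K₂ // k ≠ 1}, ‖correlation K₁ g ((k : K₂) : G) q‖ := by
  have := h.tsum_subtype_add_tsum_subtype_compl {(1 : K₂)}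
  rw [tsum_singleton (1 : K₂) (fun k : K₂ => ‖correlation K₁ g (k : G) q‖)] at this
  rw [← this]
  congr 1
  exact norm_correlation_one K₁ g q

/-- Pointwise frame bounds for the sequences `i ↦ g (x k i⁻¹)`, where `k` runs through a finite
subset of `K₂`. -/
theorem pointwise_bounds (K₁ K₂ : Subgroup G) (g : G → ℂ) (x : G) (S : Finset K₂) (a : K₂ → ℂ)
    (hsq : ∀ k ∈ S, Summable fun i : K₁ => ‖g (x * k * (i : G)⁻¹)‖ ^ 2)
    (hcorr : ∀ k ∈ S,
      Summable fun l : K₂ => ‖correlation K₁ g (l : G) (QuotientGroup.mk (x * k))‖) :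
    Summable (fun i : K₁ => ‖∑ k ∈ S, a k * conj (g (x * k * (i : G)⁻¹))‖ ^ 2) ∧
    ∑' i : K₁, ‖∑ k ∈ S, a k * conj (g (x * k * (i : G)⁻¹))‖ ^ 2 ≤
      ∑ k ∈ S, ‖a k‖ ^ 2 *
        ∑' l : K₂, ‖correlation K₁ g (l : G) (QuotientGroup.mk (x * k))‖ ∧
    ∑ k ∈ S, ‖a k‖ ^ 2 * (diagonal K₁ g (QuotientGroup.mk (x * k)) -
        ∑' l : {l : K₂ // l ≠ 1}, ‖correlation K₁ g ((l : K₂) : G) (QuotientGroup.mk (x * k))‖) ≤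
      ∑' i : K₁, ‖∑ k ∈ S, a k * conj (g (x * k * (i : G)⁻¹))‖ ^ 2 := by
  classical
  obtain ⟨h1, h2⟩ := abs_tsum_norm_sq_sub_le S a (fun k (i : K₁) => g (x * k * (i : G)⁻¹)) hsq
  -- Since `x k i⁻¹ (k l⁻¹)⁻¹ = x l i⁻¹`, row `k` of the Gram matrix is read off from the
  -- correlations at the single coset of `x k`.
  have hc : ∀ k l : K₂, ∑' i : K₁, g (x * k * (i : G)⁻¹) * conj (g (x * l * (i : G)⁻¹)) =
      correlation K₁ g ((k * l⁻¹ : K₂) : G) (QuotientGroup.mk (x * k)) := by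
    intro k l
    rw [correlation_mk]
    refine tsum_congr fun i => ?_
    congr 3
    push_cast
    rw [mul_inv_rev, inv_inv, show x * (k : G) * (i : G)⁻¹ * ((l : G) * (k : G)⁻¹) =
      x * l * (i : G)⁻¹ * (k * (k : G)⁻¹) by ac_rfl, mul_inv_cancel, mul_one]
  have h3 : ∀ k ∈ S, ∑ l ∈ S.erase k,
      ‖∑' i : K₁, g (x * k * (i : G)⁻¹) * conj (g (x * l * (i : G)⁻¹))‖ ≤
      ∑' l : {l : K₂ // l ≠ 1},
        ‖correlation K₁ g ((l : K₂) : G) (QuotientGroup.mk (x * k))‖ := by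
    intro k hk
    simp only [hc]
    -- The shift `k * l⁻¹` determines `l` and equals `1` only for `l = k`, so an off-diagonal row is
    -- part of the sum over nontrivial shifts.
    let e : K₂ → K₂ := fun l => k * l⁻¹
    have he : Function.Injective e := fun l l' h => inv_injective (mul_left_cancel h)
    have hsub : Summable fun l : {l : K₂ // l ≠ 1} =>
      ‖correlation K₁ g ((l : K₂) : G) (QuotientGroup.mk (x * k))‖ := (hcorr k hk).subtype _
    let T : Finset {l : K₂ // l ≠ 1} := ((S.erase k).image e).subtype _
    have h4 : ∑ l ∈ S.erase k, ‖correlation K₁ g ((k * l⁻¹ : K₂) : G) (QuotientGroup.mk (x * k))‖ =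
        ∑ l ∈ T, ‖correlation K₁ g ((l : K₂) : G) (QuotientGroup.mk (x * k))‖ := by
      rw [Finset.sum_subtype_of_mem
        (fun l : K₂ => ‖correlation K₁ g (l : G) (QuotientGroup.mk (x * k))‖),
        Finset.sum_image he.injOn]
      intro l hl h1
      obtain ⟨l', hl', rfl⟩ := Finset.mem_image.1 hl
      exact (Finset.mem_erase.1 hl').1 (mul_inv_eq_one.1 h1).symm
    rw [h4]
    exact hsub.sum_le_tsum T fun _ _ => norm_nonneg _
  have h4 := h2.trans (Finset.sum_le_sum fun k hk =>
    mul_le_mul_of_nonneg_left (h3 k hk) (sq_nonneg ‖a k‖))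
  obtain ⟨h5, h6⟩ := abs_le.1 h4
  refine ⟨h1, ?_, ?_⟩
  · rw [Finset.sum_congr rfl fun k hk => by rw [tsum_norm_correlation K₁ K₂ g _ (hcorr k hk)]]
    simp only [mul_add, Finset.sum_add_distrib, diagonal_mk]
    linarith
  · simp only [mul_sub, Finset.sum_sub_distrib, diagonal_mk]
    linarith

end Pointwise

/-! ### Countability and almost everywhere statements -/

section Countable

variable {G : Type*} [CommGroup G] [TopologicalSpace G] [IsTopologicalGroup G]
  [MeasurableSpace G] [BorelSpace G] (μ : Measure G) [μ.IsHaarMeasure]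
  {K : Subgroup G}

/-- Only countably many translates of a compact set under a discrete subgroup meet a set of
finite measure. -/
theorem countable_setOf_mul_mem [μ.OuterRegular] [DiscreteTopology K] {D A : Set G}
    (hD : IsCompact D) (hA : μ A < ⊤) : {k : K | ∃ x ∈ D, x * k ∈ A}.Countable := by
  -- Enlarging `A` to an open set of finite measure makes each nonempty `P a k` below open, hence of
  -- positive measure. For fixed `a` these sets are disjoint, so only countably many are nonempty.
  obtain ⟨U, hAU, hUo, hU⟩ := A.exists_isOpen_lt_of_lt _ hA
  choose V hVo hVa hVi using exists_isOpen_mem_injOn_mk K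
  obtain ⟨t, ht⟩ := hD.elim_finite_subcover V hVo
    (fun x _ => Set.mem_iUnion.2 ⟨x, hVa x⟩)
  let P : G → K → Set G := fun a k => (fun y => y * (k : G)⁻¹) ⁻¹' V a ∩ U
  have hPo : ∀ a k, IsOpen (P a k) := fun a k => ((hVo a).preimage (by fun_prop)).inter hUo
  have hP : ∀ a, {k : K | 0 < μ (P a k)}.Countable := by
    intro a
    refine Measure.countable_meas_pos_of_disjoint_of_meas_iUnion_ne_top μ
      (fun k => (hPo a k).measurableSet) ?_ ?_
    · intro k l hkl
      refine Set.disjoint_left.2 fun y hyk hyl => hkl ?_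
      have := hVi a _ hyk.1 _ hyl.1 (by
        have : (y * (k : G)⁻¹)⁻¹ * (y * (l : G)⁻¹) = k * (l : G)⁻¹ := by group
        rw [this]
        exact K.mul_mem k.2 (K.inv_mem l.2))
      exact Subtype.ext (inv_injective (mul_left_cancel this))
    · exact ((measure_mono (Set.iUnion_subset fun k => Set.inter_subset_right)).trans_lt hU).ne
  refine (t.countable_toSet.biUnion fun a _ => hP a).mono ?_
  rintro k ⟨x, hx, hxk⟩
  obtain ⟨a, ha, hxa⟩ := Set.mem_iUnion₂.1 (ht hx)
  exact Set.mem_iUnion₂.2 ⟨a, ha, (hPo a k).measure_pos μ ⟨x * k, by simpa using hxa, hAU hxk⟩⟩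

/-- The set where `g ≠ 0` is the union of the sets `1/(n+1) ≤ ‖g‖`, each of finite measure since `g
∈ L²`. -/
theorem countable_setOf_mul_ne_zero [μ.OuterRegular] [DiscreteTopology K] {D : Set G}
    (hD : IsCompact D) (g : Lp ℂ 2 μ) : {k : K | ∃ x ∈ D, g (x * (k : G)⁻¹) ≠ 0}.Countable := by
  have h : ∀ n : ℕ, μ {x | ((n : ℝ≥0∞) + 1)⁻¹ ≤ ‖g x‖ₑ} < ⊤ := fun n =>
    (Lp.memLp g).meas_ge_lt_top' two_ne_zero (by simp) (by simp)
  have h' := Set.countable_iUnion fun n => countable_setOf_mul_mem (K := K) μ hD (h n)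
  refine (h'.preimage (f := fun k : K => k⁻¹) inv_injective).mono ?_
  rintro k ⟨x, hx, hgx⟩
  obtain ⟨n, hn⟩ := ENNReal.exists_inv_nat_lt (enorm_ne_zero.2 hgx)
  refine Set.mem_iUnion.2 ⟨n, x, hx, ?_⟩
  exact (ENNReal.inv_le_inv.2 le_self_add).trans hn.le

variable {F : Set G}

/-- A `K`-invariant property which holds almost everywhere on a fundamental set holds almost
everywhere on every compact set. -/
theorem IsFundamentalSet.ae_restrict_of_invariant [T2Space G] [DiscreteTopology K]
    (hF : IsFundamentalSet K F) {p : G → Prop} (hp : ∀ x, ∀ k ∈ K, p x → p (x * k))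
    (h : ∀ᵐ x ∂μ.restrict F, p x) {D : Set G} (hD : IsCompact D) : ∀ᵐ x ∂μ.restrict D, p x := by
  obtain ⟨S, hS⟩ := hF.exists_finset hD
  refine ae_restrict_of_ae_restrict_of_subset (fun x hx => hF.mem_iUnion hS hx) ?_
  rw [ae_restrict_biUnion_finset_iff]
  intro k _
  have h1 := (measurePreserving_mul_right μ (k : G)⁻¹).restrict_preimage hF.measurable
  filter_upwards [h1.quasiMeasurePreserving.ae h] with x hx
  simpa using hp _ _ k.2 hx

/-- The translates of `F` are disjoint, so the integral of the sum over `F` is at most `‖g‖²`. Since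
`K` may be uncountable, sum and integral are exchanged only over the countable set `T`, outside
which the terms vanish on `F`. -/
theorem IsFundamentalSet.ae_summable [μ.OuterRegular] [DiscreteTopology K]
    (hF : IsFundamentalSet K F) (g : Lp ℂ 2 μ) :
    ∀ᵐ x ∂μ.restrict F, Summable fun i : K => ‖g (x * (i : G)⁻¹)‖ ^ 2 := by
  obtain ⟨D, hD, hFD⟩ := hF.relCompact
  set T := {k : K | ∃ x ∈ D, g (x * (k : G)⁻¹) ≠ 0}
  have hT : T.Countable := countable_setOf_mul_ne_zero μ hD g
  have := hT.to_subtype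
  have hgm : AEMeasurable (fun x => ‖g x‖ₑ ^ 2) μ := (Lp.aestronglyMeasurable g).enorm.pow_const 2
  have hm : ∀ a : G, AEMeasurable (fun x => ‖g (x * a)‖ₑ ^ 2) (μ.restrict F) := fun a =>
    (hgm.comp_quasiMeasurePreserving
      (measurePreserving_mul_right μ a).quasiMeasurePreserving).restrict
  have h1 : ∫⁻ x in F, ∑' i : T, ‖g (x * ((i : K) : G)⁻¹)‖ₑ ^ 2 ∂μ ≤ ∫⁻ x, ‖g x‖ₑ ^ 2 ∂μ := by
    rw [lintegral_tsum fun i => hm _]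
    have h2 : ∀ k : K, ∫⁻ x in F, ‖g (x * (k : G)⁻¹)‖ₑ ^ 2 ∂μ =
        ∫⁻ x in (fun x => x * ((k⁻¹ : K) : G)⁻¹) ⁻¹' F, ‖g x‖ₑ ^ 2 ∂μ := by
      intro k
      have h := (measurePreserving_mul_right μ (k : G)⁻¹).restrict_preimage_emb
        (measurableEmbedding_mulRight _) ((fun x => x * ((k⁻¹ : K) : G)⁻¹) ⁻¹' F)
      rw [← h.lintegral_comp_emb (measurableEmbedding_mulRight _)]
      congr 2
      ext x
      simp
    simp only [h2]
    rw [← lintegral_iUnion (fun i => hF.measurable.preimage (by fun_prop))]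
    · exact setLIntegral_le_lintegral _ _
    · intro i j hij
      exact hF.pairwiseDisjoint Set.univ (Set.mem_univ _) (Set.mem_univ _)
        fun h => hij (Subtype.ext (inv_injective h))
  have h3 : ∫⁻ x, ‖g x‖ₑ ^ 2 ∂μ < ⊤ := by
    rw [← eLpNorm_two_sq]
    exact ENNReal.pow_lt_top (Lp.eLpNorm_lt_top g)
  have h4 := ae_lt_top' (AEMeasurable.tsum fun i : T => hm ((i : K) : G)⁻¹) (h1.trans_lt h3).ne
  filter_upwards [h4, ae_restrict_mem hF.measurable] with x hx hxF
  have h5 : ∑' i : K, ‖g (x * (i : G)⁻¹)‖ₑ ^ 2 < ⊤ := by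
    rwa [← tsum_subtype_eq_of_support_subset (s := T)]
    intro i hi
    refine ⟨x, hFD hxF, fun h => hi ?_⟩
    simp [h]
  have h6 := ENNReal.summable_toReal h5.ne
  simpa using h6

end Countable

/-! ### Frame inequalities from a dense subset -/

section Density

variable {ι H : Type*} [NormedAddCommGroup H] [InnerProductSpace ℂ H]

theorem ofReal_norm_sq {E : Type*} [SeminormedAddCommGroup E] (x : E) :
    ENNReal.ofReal (‖x‖ ^ 2) = ‖x‖ₑ ^ 2 := by
  rw [ENNReal.ofReal_pow (norm_nonneg _), ofReal_norm]

/-- Each finite partial sum is continuous in `f`, so its bound passes to the closure; then take all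
finite sets. -/
theorem isBesselWithBound_of_dense {v : ι → H} {B : ℝ} (hB : 0 ≤ B) {D : Set H} (hD : Dense D)
    (h : ∀ d ∈ D, ∑' i, ‖inner ℂ (v i) d‖ₑ ^ 2 ≤ ENNReal.ofReal B * ‖d‖ₑ ^ 2) :
    IsBesselWithBound v B := by
  have key : ∀ (s : Finset ι) (f : H), ∑ i ∈ s, ‖inner ℂ (v i) f‖ ^ 2 ≤ B * ‖f‖ ^ 2 := by
    intro s
    have hc : IsClosed {f : H | ∑ i ∈ s, ‖inner ℂ (v i) f‖ ^ 2 ≤ B * ‖f‖ ^ 2} :=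
      isClosed_le (by fun_prop) (by fun_prop)
    intro f
    refine hc.closure_subset_iff.2 (fun d hd => ?_) (hD f)
    have h1 := (ENNReal.sum_le_tsum s).trans (h d hd)
    simp only [← ofReal_norm_sq] at h1
    rw [← ENNReal.ofReal_mul hB, ← ENNReal.ofReal_sum_of_nonneg fun _ _ => by positivity] at h1
    exact (ENNReal.ofReal_le_ofReal_iff (by positivity)).1 h1
  intro f
  have hs := summable_of_sum_le (fun i => sq_nonneg ‖inner ℂ (v i) f‖) fun s => key s f
  exact ⟨hs, hs.tsum_le_of_sum_le fun s => key s f⟩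

theorem IsBesselWithBound.memℓp {v : ι → H} {B : ℝ} (hv : IsBesselWithBound v B) (f : H) :
    Memℓp (fun i => (inner ℂ (v i) f : ℂ)) 2 :=
  memℓp_gen (by simpa using (hv f).1)

theorem norm_sq_lp_two (x : lp (fun _ : ι => ℂ) 2) : ‖x‖ ^ 2 = ∑' i, ‖x i‖ ^ 2 := by
  have h1 := lp.norm_rpow_eq_tsum (p := 2) (by simp) x
  simpa using h1

/-- The analysis operator of a Bessel family. -/
noncomputable def analysisOperator {v : ι → H} {B : ℝ} (hv : IsBesselWithBound v B) :
    H →L[ℂ] lp (fun _ : ι => ℂ) 2 :=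
  LinearMap.mkContinuous
    { toFun := fun f => ⟨fun i => inner ℂ (v i) f, hv.memℓp f⟩
      map_add' := fun f f' => by ext i; exact inner_add_right _ _ _
      map_smul' := fun c f => by ext i; exact inner_smul_right _ _ _ }
    (Real.sqrt B) (fun f => by
      rw [← Real.sqrt_sq (norm_nonneg f), ← Real.sqrt_mul' _ (sq_nonneg _)]
      refine Real.le_sqrt_of_sq_le ?_
      rw [norm_sq_lp_two]
      exact (hv f).2)

/-- A lower bound is not inherited by partial sums. The Bessel bound supplies continuity of the full
sum, as the squared norm of the bounded analysis operator. -/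
theorem le_tsum_of_dense {v : ι → H} {A B : ℝ} (hv : IsBesselWithBound v B) (hA : 0 ≤ A)
    {D : Set H} (hD : Dense D)
    (h : ∀ d ∈ D, ENNReal.ofReal A * ‖d‖ₑ ^ 2 ≤ ∑' i, ‖inner ℂ (v i) d‖ₑ ^ 2) (f : H) :
    A * ‖f‖ ^ 2 ≤ ∑' i, ‖inner ℂ (v i) f‖ ^ 2 := by
  have hT : ∀ f, ‖analysisOperator hv f‖ ^ 2 = ∑' i, ‖inner ℂ (v i) f‖ ^ 2 := by
    intro f
    exact norm_sq_lp_two _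
  rw [← hT]
  have hc : IsClosed {f : H | A * ‖f‖ ^ 2 ≤ ‖analysisOperator hv f‖ ^ 2} :=
    isClosed_le (by fun_prop) (by fun_prop)
  refine hc.closure_subset_iff.2 (fun d hd => ?_) (hD f)
  have h1 := h d hd
  simp only [← ofReal_norm_sq] at h1
  rw [← ENNReal.ofReal_mul hA, ← ENNReal.ofReal_tsum_of_nonneg (fun _ => by positivity)
    (hv d).1] at h1
  change _ ≤ ‖analysisOperator hv d‖ ^ 2
  rw [hT]
  exact (ENNReal.ofReal_le_ofReal_iff (tsum_nonneg fun _ => by positivity)).1 h1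

end Density

/-! ### Gabor coefficients and the frame estimates -/

section Gabor

variable {G : Type*} [CommGroup G] [TopologicalSpace G] [IsTopologicalGroup G]
  [LocallyCompactSpace G] [T2Space G] [MeasurableSpace G] [BorelSpace G]
  (μ : Measure G) [μ.IsHaarMeasure] {K₁ K₂ : Subgroup G}

theorem memLp_mul_conj_translate {f : G → ℂ} (hf : Measurable f) {C : ℝ} (hC : ∀ x, ‖f x‖ ≤ C)
    (g : Lp ℂ 2 μ) (a : G) : MemLp (fun x => f x * conj (g (x * a))) 2 μ := by
  have h1 : MemLp (fun t : G => g (t * a)) 2 μ :=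
    (Lp.memLp g).comp_measurePreserving (measurePreserving_mul_right μ a)
  refine h1.of_le_mul (c := C)
    (hf.aestronglyMeasurable.mul (Complex.continuous_conj.comp_aestronglyMeasurable h1.1)) ?_
  refine Filter.Eventually.of_forall fun x => ?_
  rw [norm_mul, RCLike.norm_conj]
  gcongr
  exact hC x

/-- The inner products with a generalized Gabor system are Fourier coefficients of
periodizations. -/
theorem inner_gaborSystem {F : Set G} (hF : IsFundamentalSet K₂ F) {f : G → ℂ}
    (hf2 : MemLp f 2 μ) {S : Finset K₂} (hS : ∀ x ∈ F, ∀ k : K₂, x * k ∈ tsupport f → k ∈ S)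
    (g : Lp ℂ 2 μ) (i : K₁)
    (γ : annihilator K₂) :
    inner ℂ (gaborSystem μ K₁ K₂ g (i, γ)) (hf2.toLp f) =
      ∫ x in F, conj ((γ : PontryaginDual G) x : ℂ) *
        ∑ k ∈ S, f (x * k) * conj (g (x * k * (i : G)⁻¹)) ∂μ := by
  have hγ : Continuous fun x : G => conj ((γ : PontryaginDual G) x : ℂ) :=
    Complex.continuous_conj.comp (continuous_subtype_val.comp (map_continuous _))
  set h : G → ℂ := fun x =>
    conj ((γ : PontryaginDual G) x : ℂ) * (f x * conj (g (x * (i : G)⁻¹))) with hh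
  have hae : (fun x => inner ℂ (gaborSystem μ K₁ K₂ g (i, γ) x) (hf2.toLp f x)) =ᵐ[μ] h := by
    filter_upwards [hf2.coeFn_toLp, (memLp_timeFreq μ g (i : G) γ).coeFn_toLp] with x hx1 hx2
    rw [gaborSystem, timeFreq, hx1, hx2, RCLike.inner_apply, map_mul]
    simp only [hh]
    ring
  have hi : Integrable h μ := (L2.integrable_inner _ _).congr hae
  rw [L2.inner_def, integral_congr_ae hae, hF.integral_eq_sum μ hS (fun x hx => by
    simp [hh, image_eq_zero_of_notMem_tsupport hx]) hi, ← integral_finsetSum]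
  · refine integral_congr_ae (Filter.Eventually.of_forall fun x => ?_)
    simp only [hh, Finset.mul_sum]
    refine Finset.sum_congr rfl fun k _ => ?_
    -- Characters in the annihilator are `K₂`-periodic, so they factor out of the sum over
    -- translates.
    have h1 : (γ : PontryaginDual G) (x * k) = (γ : PontryaginDual G) x := by
      rw [map_mul, γ.2 _ k.2, mul_one]
    rw [h1]
  · intro k _
    exact (hi.comp_mul_right (k : G)).restrict

variable [μ.Regular] (hK₁ : IsUniformLattice K₁) (hK₂ : IsUniformLattice K₂)

/-- Parseval is applied in `γ` for each `i ∈ K₁`. The sum over `i` then moves inside the integral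
because only countably many `φ i` are not identically zero on `F`. -/
theorem tsum_enorm_inner_gaborSystem [DiscreteTopology K₁] {f : G → ℂ}
    (hf : Measurable f) {C : ℝ} (hC : ∀ x, ‖f x‖ ≤ C) (hf2 : MemLp f 2 μ) {S : Finset K₂}
    (hS : ∀ x ∈ fundamentalSet hK₂, ∀ k : K₂, x * k ∈ tsupport f → k ∈ S) (g : Lp ℂ 2 μ) :
    ∑' p, ‖inner ℂ (gaborSystem μ K₁ K₂ g p) (hf2.toLp f)‖ₑ ^ 2 =
      quotientMeasure μ hK₂ Set.univ * ∫⁻ x in fundamentalSet hK₂,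
        ∑' i : K₁, ‖∑ k ∈ S, f (x * k) * conj (g (x * k * (i : G)⁻¹))‖ₑ ^ 2 ∂μ := by
  have hF := isFundamentalSet_fundamentalSet hK₂
  set F := fundamentalSet hK₂
  set φ : K₁ → G → ℂ := fun i x => ∑ k ∈ S, f (x * k) * conj (g (x * k * (i : G)⁻¹))
  have hφ : ∀ i, MemLp (φ i) 2 (μ.restrict F) := fun i => MemLp.restrict F
    (memLp_finsetSum S fun k _ =>
      (memLp_mul_conj_translate μ hf hC g (i : G)⁻¹).comp_measurePreserving
        (measurePreserving_mul_right μ (k : G)))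
  rw [ENNReal.tsum_prod']
  have h1 : ∀ i : K₁, ∑' γ : annihilator K₂,
      ‖inner ℂ (gaborSystem μ K₁ K₂ g (i, γ)) (hf2.toLp f)‖ₑ ^ 2 =
      quotientMeasure μ hK₂ Set.univ * ∫⁻ x in F, ‖φ i x‖ₑ ^ 2 ∂μ := by
    intro i
    simp only [inner_gaborSystem μ hF hf2 hS g i]
    exact tsum_enorm_integral_annihilator μ hK₂ (hφ i)
  simp only [h1]
  rw [ENNReal.tsum_mul_left]
  congr 1
  obtain ⟨D, hD, hFD⟩ := hF.relCompact
  set D' : Set G := ⋃ k ∈ S, (· * (k : G)) '' D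
  have hD' : IsCompact D' := S.isCompact_biUnion fun k _ => hD.image (by fun_prop)
  set T := {k : K₁ | ∃ x ∈ D', g (x * (k : G)⁻¹) ≠ 0}
  have hT : T.Countable := countable_setOf_mul_ne_zero μ hD' g
  have := hT.to_subtype
  have h0 : ∀ i ∉ T, ∀ x ∈ F, φ i x = 0 := by
    intro i hi x hx
    refine Finset.sum_eq_zero fun k hk => ?_
    have : g (x * k * (i : G)⁻¹) = 0 := by
      by_contra hne
      exact hi ⟨x * k, Set.mem_iUnion₂.2 ⟨k, hk, x, hFD hx, rfl⟩, hne⟩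
    rw [this, map_zero, mul_zero]
  rw [← tsum_subtype_eq_of_support_subset (s := T)]
  · rw [← lintegral_tsum fun i : T => ((hφ i).1.enorm.pow_const 2)]
    refine setLIntegral_congr_fun hF.measurable fun x hx => ?_
    refine tsum_subtype_eq_of_support_subset (f := fun i => ‖φ i x‖ₑ ^ 2) fun i hi => ?_
    by_contra hiT
    exact hi (by simp [h0 i hiT x hx])
  · intro i hi
    by_contra hiT
    refine hi ((setLIntegral_congr_fun (g := fun _ => 0) hF.measurable fun x hx => ?_).trans
      lintegral_zero)
    simp [h0 i hiT x hx]

/-- Properties of almost all cosets of `K₁` transfer to the translates of a compact set. -/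
theorem ae_restrict_mul_of_ae {p : G → Prop} (hp : ∀ x, ∀ k ∈ K₁, p x → p (x * k))
    (h : ∀ᵐ x ∂μ.restrict (fundamentalSet hK₁), p x) (a : G) :
    ∀ᵐ x ∂μ.restrict (fundamentalSet hK₂), p (x * a) := by
  have := hK₁.discrete
  obtain ⟨D, hD, hFD⟩ := (isFundamentalSet_fundamentalSet hK₂).relCompact
  have h1 := (isFundamentalSet_fundamentalSet hK₁).ae_restrict_of_invariant μ hp h
    (hD.image (f := (· * a)) (by fun_prop))
  have h2 := (measurePreserving_mul_right μ a).restrict_preimage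
    (hD.image (f := (· * a)) (by fun_prop)).measurableSet
  refine ae_restrict_of_ae_restrict_of_subset (fun x hx => ?_) (h2.quasiMeasurePreserving.ae h1)
  exact ⟨x, hFD hx, rfl⟩

theorem lintegral_sum_translates {F : Set G} (hF : IsFundamentalSet K₂ F) {f : G → ℂ}
    (hf : Measurable f) (hf2 : MemLp f 2 μ) {S : Finset K₂}
    (hS : ∀ x ∈ F, ∀ k : K₂, x * k ∈ tsupport f → k ∈ S) :
    ∫⁻ x in F, ENNReal.ofReal (∑ k ∈ S, ‖f (x * k)‖ ^ 2) ∂μ = ‖hf2.toLp f‖ₑ ^ 2 := by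
  have h1 : ‖hf2.toLp f‖ₑ = eLpNorm f 2 μ := Lp.enorm_toLp hf2
  rw [h1, eLpNorm_two_sq,
    hF.lintegral_eq_sum μ hS (fun x hx => by simp [image_eq_zero_of_notMem_tsupport hx]),
    ← lintegral_finsetSum S fun k _ => by fun_prop]
  refine lintegral_congr fun x => ?_
  rw [ENNReal.ofReal_sum_of_nonneg fun _ _ => by positivity]
  simp only [ofReal_norm_sq]

/-- Almost everywhere bounds on the correlation functions give frame inequalities for
bounded measurable functions with compact support. -/
theorem gaborSystem_bounds_of_ae (g : Lp ℂ 2 μ) {b : ℝ} (hb : 0 ≤ b)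
    (hs : ∀ᵐ q ∂quotientMeasure μ hK₁, Summable fun l : K₂ => ‖correlation K₁ g (l : G) q‖)
    (hle : ∀ᵐ q ∂quotientMeasure μ hK₁, ∑' l : K₂, ‖correlation K₁ g (l : G) q‖ ≤ b)
    {f : G → ℂ} (hf : Measurable f) {C : ℝ} (hC : ∀ x, ‖f x‖ ≤ C)
    (hfc : HasCompactSupport f) (hf2 : MemLp f 2 μ) :
    ∑' p, ‖inner ℂ (gaborSystem μ K₁ K₂ g p) (hf2.toLp f)‖ₑ ^ 2 ≤
        quotientMeasure μ hK₂ Set.univ * ENNReal.ofReal b * ‖hf2.toLp f‖ₑ ^ 2 ∧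
    ∀ a : ℝ, 0 ≤ a → (∀ᵐ q ∂quotientMeasure μ hK₁, a ≤ diagonal K₁ g q -
        ∑' l : {l : K₂ // l ≠ 1}, ‖correlation K₁ g ((l : K₂) : G) q‖) →
      quotientMeasure μ hK₂ Set.univ * ENNReal.ofReal a * ‖hf2.toLp f‖ₑ ^ 2 ≤
        ∑' p, ‖inner ℂ (gaborSystem μ K₁ K₂ g p) (hf2.toLp f)‖ₑ ^ 2 := by
  have := hK₁.discrete
  have := hK₂.discrete
  have hF := isFundamentalSet_fundamentalSet hK₂
  obtain ⟨S, hS⟩ := hF.exists_finset hfc.isCompact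
  -- The hypotheses concern cosets of `K₁`, whereas the integrals run over a fundamental set of
  -- `K₂`.
  have transfer : ∀ p : G ⧸ K₁ → Prop, (∀ᵐ q ∂quotientMeasure μ hK₁, p q) →
      ∀ᵐ x ∂μ.restrict (fundamentalSet hK₂), ∀ k ∈ S, p (QuotientGroup.mk (x * k)) := by
    intro p hp
    refine (ae_ball_iff S.countable_toSet).2 fun k _ => ?_
    refine ae_restrict_mul_of_ae (p := fun x => p (QuotientGroup.mk x)) μ hK₁ hK₂ ?_
      (ae_of_ae_map QuotientGroup.measurable_coe.aemeasurable hp) (k : G)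
    intro x l hl hx
    have : (QuotientGroup.mk (x * l) : G ⧸ K₁) = QuotientGroup.mk x :=
      QuotientGroup.mk_mul_of_mem x hl
    rwa [this]
  have hsq : ∀ᵐ x ∂μ.restrict (fundamentalSet hK₂), ∀ k ∈ S,
      Summable fun i : K₁ => ‖g (x * k * (i : G)⁻¹)‖ ^ 2 := by
    refine (ae_ball_iff S.countable_toSet).2 fun k _ => ?_
    refine ae_restrict_mul_of_ae (p := fun x => Summable fun i : K₁ => ‖g (x * (i : G)⁻¹)‖ ^ 2)
      μ hK₁ hK₂ ?_ ((isFundamentalSet_fundamentalSet hK₁).ae_summable μ g) (k : G)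
    intro x l hl hx
    refine (((Equiv.mulRight (⟨l, hl⟩ : K₁)⁻¹).summable_iff).2 hx).congr fun i => ?_
    simp [mul_assoc]
  -- The frame sum and `‖f‖²` become integrals over the same fundamental set, so pointwise
  -- comparison suffices.
  rw [tsum_enorm_inner_gaborSystem μ hK₂ hf hC hf2 hS g, mul_assoc,
    ← lintegral_sum_translates μ hF hf hf2 hS, ← lintegral_const_mul' _ _ ENNReal.ofReal_ne_top]
  have hconv : ∀ x, Summable (fun i : K₁ =>
      ‖∑ k ∈ S, f (x * k) * conj (g (x * k * (i : G)⁻¹))‖ ^ 2) →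
      ∑' i : K₁, ‖∑ k ∈ S, f (x * k) * conj (g (x * k * (i : G)⁻¹))‖ₑ ^ 2 =
      ENNReal.ofReal (∑' i : K₁, ‖∑ k ∈ S, f (x * k) * conj (g (x * k * (i : G)⁻¹))‖ ^ 2) := by
    intro x hx
    rw [ENNReal.ofReal_tsum_of_nonneg (fun _ => by positivity) hx]
    simp only [ofReal_norm_sq]
  constructor
  · gcongr _ * ?_
    refine lintegral_mono_ae ?_
    filter_upwards [hsq, transfer _ hs, transfer _ hle] with x h1 h2 h3
    obtain ⟨h4, h5, -⟩ := pointwise_bounds K₁ K₂ g x S (fun k => f (x * k)) h1 h2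
    rw [hconv x h4, ← ENNReal.ofReal_mul hb]
    refine ENNReal.ofReal_le_ofReal (h5.trans ?_)
    rw [Finset.mul_sum]
    refine Finset.sum_le_sum fun k hk => ?_
    rw [mul_comm b]
    exact mul_le_mul_of_nonneg_left (h3 k hk) (sq_nonneg _)
  · intro a ha hae
    rw [mul_assoc, ← lintegral_const_mul' _ _ ENNReal.ofReal_ne_top]
    gcongr _ * ?_
    refine lintegral_mono_ae ?_
    filter_upwards [hsq, transfer _ hs, transfer _ hae] with x h1 h2 h3
    obtain ⟨h4, -, h5⟩ := pointwise_bounds K₁ K₂ g x S (fun k => f (x * k)) h1 h2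
    rw [hconv x h4, ← ENNReal.ofReal_mul ha]
    refine ENNReal.ofReal_le_ofReal (le_trans ?_ h5)
    rw [Finset.mul_sum]
    refine Finset.sum_le_sum fun k hk => ?_
    rw [mul_comm a]
    exact mul_le_mul_of_nonneg_left (h3 k hk) (sq_nonneg _)

/-- The bounded measurable functions with compact support are dense in `L²`. -/
theorem dense_bounded_hasCompactSupport :
    Dense {u : Lp ℂ 2 μ | ∃ (f : G → ℂ) (hf2 : MemLp f 2 μ), Measurable f ∧
      (∃ C : ℝ, ∀ x, ‖f x‖ ≤ C) ∧ HasCompactSupport f ∧ u = hf2.toLp f} := by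
  intro u
  rw [EMetric.mem_closure_iff]
  intro ε hε
  obtain ⟨δ, hδ, hδε⟩ := exists_between hε
  obtain ⟨f, hfu, hf, hfC, hfc⟩ := (Lp.memLp u).induction_dense (by simp)
    (fun f => Measurable f ∧ (∃ C : ℝ, ∀ x, ‖f x‖ ≤ C) ∧ HasCompactSupport f)
    (by
      intro c t ht htμ ε hε
      obtain ⟨η, ηpos, hη⟩ := exists_eLpNorm_indicator_le (μ := μ) (p := 2) (by simp) c hε
      -- Inner regularity replaces `t` by a compact subset with remainder below `η`; its indicator
      -- already belongs to the class.
      have hη' : (η : ℝ≥0∞) ≠ 0 := ENNReal.coe_ne_zero.2 ηpos.ne'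
      obtain ⟨s, st, s_compact, μs⟩ := ht.exists_isCompact_sdiff_lt htμ.ne hη'
      refine ⟨s.indicator fun _ => c, ?_, measurable_const.indicator s_compact.measurableSet,
        ⟨‖c‖, fun x => norm_indicator_le_norm_self (fun _ => c) x⟩,
        HasCompactSupport.intro s_compact fun x hx => Set.indicator_of_notMem hx _⟩
      rw [← eLpNorm_neg, neg_sub, ← Set.indicator_sdiff st]
      exact hη _ μs.le)
    (by
      rintro f f' ⟨hf, ⟨C, hC⟩, hfc⟩ ⟨hf', ⟨C', hC'⟩, hfc'⟩
      exact ⟨hf.add hf', ⟨C + C', fun x => (norm_add_le _ _).trans (add_le_add (hC x) (hC' x))⟩,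
        hfc.add hfc'⟩)
    (fun f hf => hf.1.aestronglyMeasurable) hδ.ne'
  have hf2 : MemLp f 2 μ := by
    have h : MemLp (⇑u - f) 2 μ :=
      ⟨(Lp.aestronglyMeasurable u).sub hf.aestronglyMeasurable, hfu.trans_lt (lt_top_of_lt hδε)⟩
    have h' := (Lp.memLp u).sub h
    rwa [sub_sub_cancel] at h'
  refine ⟨hf2.toLp f, ⟨f, hf2, hf, hfC, hfc, rfl⟩, lt_of_le_of_lt ?_ hδε⟩
  rw [Lp.edist_def]
  refine (eLpNorm_congr_ae ?_).trans_le hfu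
  filter_upwards [hf2.coeFn_toLp] with x hx
  simp [hx]

/-- An essential infimum of a real function which is not a junk value is an essential lower
bound. -/
theorem ae_essInf_le_of_pos {α : Type*} [MeasurableSpace α] {ν : Measure α} {u : α → ℝ}
    (h : 0 < essInf u ν) : ∀ᵐ x ∂ν, essInf u ν ≤ u x := by
  refine ae_essInf_le ?_
  rw [essInf_eq_sSup] at h
  -- With no essential lower bound the real `essInf` would be `sSup ∅ = 0`, which positivity
  -- excludes.
  have hne : {a | ν {x | u x < a} = 0}.Nonempty := by
    by_contra hne
    rw [Set.not_nonempty_iff_eq_empty.1 hne, Real.sSup_empty] at h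
    exact h.false
  obtain ⟨a, ha⟩ := hne
  refine ⟨a, ?_⟩
  rw [Filter.eventually_map]
  have : ∀ᵐ x ∂ν, ¬ u x < a := by simpa [ae_iff] using ha
  filter_upwards [this] with x hx using not_lt.1 hx

end Gabor

end GenGabor

/-! ### The main theorem -/

open GenGabor

theorem theorem4 {G : Type*} [CommGroup G] [TopologicalSpace G] [IsTopologicalGroup G]
    [LocallyCompactSpace G] [T2Space G] [MeasurableSpace G] [BorelSpace G]
    (μ : Measure G) [μ.IsHaarMeasure] [μ.Regular]
    (K₁ K₂ : Subgroup G) (hK₁ : GenGabor.IsUniformLattice K₁) (hK₂ : GenGabor.IsUniformLattice K₂)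
    (g : Lp ℂ 2 μ) (hB : GenGabor.upperBound μ hK₁ hK₂ g < ⊤) :
    GenGabor.IsBesselWithBound (GenGabor.gaborSystem μ K₁ K₂ g)
        (GenGabor.upperBound μ hK₁ hK₂ g).toReal ∧
      (0 < GenGabor.lowerBound μ hK₁ hK₂ g →
        GenGabor.IsFrameWithBounds (GenGabor.gaborSystem μ K₁ K₂ g)
          (GenGabor.lowerBound μ hK₁ hK₂ g) (GenGabor.upperBound μ hK₁ hK₂ g).toReal) := by
  have := hK₁.discrete
  have := hK₂.discrete
  have := isFiniteMeasure_quotientMeasure μ hK₂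
  have hm0 : ∀ {K : Subgroup G} (hK : IsUniformLattice K),
      quotientMeasure μ hK Set.univ ≠ 0 := fun {K} hK => by
    have := hK.discrete
    rw [quotientMeasure_univ]
    exact (isFundamentalSet_fundamentalSet hK).measure_ne_zero μ
  set m := quotientMeasure μ hK₂ Set.univ with hm
  set M := essSup (fun x : G ⧸ K₁ => ∑' k₂ : K₂, ‖correlation K₁ g (k₂ : G) x‖ₑ)
      (quotientMeasure μ hK₁) with hM
  have hB' : upperBound μ hK₁ hK₂ g = m * M := rfl
  -- In `ℝ≥0∞` a finite product bounds `M` only because the other factor, the mass of `G ⧸ K₂`, is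
  -- nonzero.
  have hMtop : M ≠ ⊤ := (ENNReal.lt_top_of_mul_ne_top_right (hB' ▸ hB.ne) (hm0 hK₂)).ne
  have hae : ∀ᵐ q ∂quotientMeasure μ hK₁,
      ∑' k₂ : K₂, ‖correlation K₁ g (k₂ : G) q‖ₑ ≤ M := ENNReal.ae_le_essSup _
  have hs : ∀ᵐ q ∂quotientMeasure μ hK₁,
      Summable fun l : K₂ => ‖correlation K₁ g (l : G) q‖ := by
    filter_upwards [hae] with q hq
    simpa using ENNReal.summable_toReal (hq.trans_lt hMtop.lt_top).ne
  have hle : ∀ᵐ q ∂quotientMeasure μ hK₁,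
      ∑' l : K₂, ‖correlation K₁ g (l : G) q‖ ≤ M.toReal := by
    filter_upwards [hae] with q hq
    have := ENNReal.toReal_mono hMtop hq
    rw [ENNReal.tsum_toReal_eq fun _ => enorm_ne_top] at this
    simpa using this
  have hbessel : IsBesselWithBound (gaborSystem μ K₁ K₂ g) (upperBound μ hK₁ hK₂ g).toReal := by
    refine isBesselWithBound_of_dense ENNReal.toReal_nonneg (dense_bounded_hasCompactSupport μ) ?_
    rintro _ ⟨f, hf2, hf, ⟨C, hC⟩, hfc, rfl⟩
    have h := (gaborSystem_bounds_of_ae μ hK₁ hK₂ g ENNReal.toReal_nonneg hs hle hf hC hfc hf2).1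
    rwa [ENNReal.ofReal_toReal hMtop, ← hB', ← ENNReal.ofReal_toReal hB.ne] at h
  refine ⟨hbessel, fun hA => ?_⟩
  set a := essInf (fun x : G ⧸ K₁ => diagonal K₁ g x -
        ∑' k₂ : {k : K₂ // k ≠ 1}, ‖correlation K₁ g ((k₂ : K₂) : G) x‖)
      (quotientMeasure μ hK₁) with ha
  have hA' : lowerBound μ hK₁ hK₂ g = m.toReal * a := rfl
  have hapos : 0 < a := pos_of_mul_pos_right (hA' ▸ hA) ENNReal.toReal_nonneg
  have hlow := ae_essInf_le_of_pos hapos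
  -- At almost every coset `a ≤ diagonal - off ≤ diagonal + off ≤ M`, where `off` is the sum over
  -- nontrivial shifts. Such a coset exists because `G ⧸ K₁` has nonzero measure.
  have hBpos : 0 < (upperBound μ hK₁ hK₂ g).toReal := by
    have : (ae (quotientMeasure μ hK₁)).NeBot := ae_neBot.2 fun h => hm0 hK₁ (by rw [h]; rfl)
    obtain ⟨q, h1, h2, h3⟩ := (hs.and (hle.and hlow)).exists
    rw [tsum_norm_correlation K₁ K₂ g q h1] at h2
    have h4 : 0 ≤ ∑' k₂ : {k : K₂ // k ≠ 1}, ‖correlation K₁ g ((k₂ : K₂) : G) q‖ :=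
      tsum_nonneg fun _ => norm_nonneg _
    rw [hB', ENNReal.toReal_mul]
    exact mul_pos (ENNReal.toReal_pos (hm0 hK₂) (measure_ne_top _ _)) (by linarith)
  refine ⟨hA, hBpos, fun f => ⟨(hbessel f).1, ?_, (hbessel f).2⟩⟩
  refine le_tsum_of_dense hbessel hA.le (dense_bounded_hasCompactSupport μ) ?_ f
  rintro _ ⟨f, hf2, hf, ⟨C, hC⟩, hfc, rfl⟩
  have h := (gaborSystem_bounds_of_ae μ hK₁ hK₂ g ENNReal.toReal_nonneg hs hle hf hC hfc hf2).2
    a hapos.le hlow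
  rwa [hA', ENNReal.ofReal_mul ENNReal.toReal_nonneg, ENNReal.ofReal_toReal (measure_ne_top _ _)]
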